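/- Let $\mathbb F$ be a non-archimedean local field of characteristic zero and let $\psi:\mathbb F\to S^1$ be a nontrivial continuous additive character. For $n\ge 0$ let $V_n=\mathbb F^n$ (column vectors), let $V_n^*$ be its dual (row vectors), and let $\mathrm{sl}(V_n)$ be the space of trace-zero operators on $V_n$. Let $G_n=\mathrm{GL}(n,\mathbb F)$ and $\widetilde G_n=G_n\rtimes S_2$, where the generator $T$ of $S_2$ acts on $G_n$ by $g\mapsto {}^tg^{-1}$. The group $\widetilde G_n$ acts on $\mathrm{sl}(V_n)$ by $g\cdot A=gAg^{-1}$, $T\cdot A={}^tA$, and on $V_n\oplus V_n^*$ by $g\cdot(v,\phi)=(gv,\phi g^{-1})$, $T\cdot(v,\phi)=({}^t\phi,{}^tv)$. For a nilpotent $A\in\mathrm{sl}(V_n)$ let $C_A\subset G_n$ and $\widetilde C_A\subset\widetilde G_n$ be the stabilizers of $A$, and let $$Q_A=\{(v,\phi)\in V_n\oplus V_n^* : v\otimes\phi\in[A,\mathrm{gl}(V_n)]\}.$$ Let $\mathcal S(V_n\oplus V_n^*)$ be the space of locally constant compactly supported complex functions and $\mathcal S^*(V_n\oplus V_n^*)$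 its linear dual, the space of distributions. Let $B$ be the symmetric bilinear form on $V_n\oplus V_n^*$ with $B((v,\phi),(v,\phi))=\phi(v)$, put $\mathcal F(f)(y)=\int f(x)\psi(B(x,y))\,dx$ for $f\in\mathcal S(V_n\oplus V_n^*)$, with $dx$ the self-dual Haar measure, and $\mathcal F(\eta)(f)=\eta(\mathcal F(f))$ for distributions $\eta$. Call a nilpotent $A\in\mathrm{sl}(V_n)$ \emph{nice} if every $C_A$-invariant distribution $\eta\in\mathcal S^*(V_n\oplus V_n^*)$ such that both $\eta$ and $\mathcal F(\eta)$ are supported in $Q_A$ is $\widetilde C_A$-invariant. \textbf{Lemma.} If $A_1\in\mathrm{sl}(V_k)$ and $A_2\in\mathrm{sl}(V_l)$ are nice nilpotent elements, then $A_1\oplus A_2\in\mathrm{sl}(V_{k+l})$ is nice. -/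

import Mathlib

namespace GLMultOne

open MeasureTheory ValuativeRel Matrix Topology

set_option linter.unusedSectionVars false

section Distributions

variable (X : Type*) [TopologicalSpace X]

/-- Schwartz functions on an l-space: locally constant complex functions of compact support. -/
def Schwartz : Submodule ℂ (X → ℂ) where
  carrier := {f | IsLocallyConstant f ∧ HasCompactSupport f}
  add_mem' := fun hf hg => ⟨hf.1.add hg.1, hf.2.add hg.2⟩
  zero_mem' := ⟨IsLocallyConstant.const 0, HasCompactSupport.zero⟩
  smul_mem' := fun c _ hf => ⟨hf.1.comp (fun z => c • z), hf.2.smul_left (f := fun _ => c)⟩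

/-- Distributions on an l-space: arbitrary linear functionals on the Schwartz functions. -/
abbrev Distr : Type _ := Schwartz X →ₗ[ℂ] ℂ

variable {X}

/-- `ξ` vanishes on `U` if it kills every Schwartz function supported in `U`. -/
def Distr.VanishesOn (ξ : Distr X) (U : Set X) : Prop :=
  ∀ f : Schwartz X, tsupport (f : X → ℂ) ⊆ U → ξ f = 0

/-- The support: the complement of the union of all open sets on which `ξ` vanishes. -/
def Distr.supp (ξ : Distr X) : Set X :=
  (⋃₀ {U : Set X | IsOpen U ∧ ξ.VanishesOn U})ᶜ

variable {H : Type*} [Group H] [MulAction H X] [ContinuousConstSMul H X]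

/-- Composition with the action of a group element, `f ↦ (x ↦ f (h • x))`. -/
def Schwartz.translate (h : H) : Schwartz X →ₗ[ℂ] Schwartz X where
  toFun f := ⟨fun x => (f : X → ℂ) (h • x), f.2.1.comp_continuous (continuous_const_smul h),
    f.2.2.comp_homeomorph (Homeomorph.smul h)⟩
  map_add' _ _ := rfl
  map_smul' _ _ := rfl

/-- Invariance of a distribution under a subgroup. -/
def Distr.IsInvariant (ξ : Distr X) (K : Subgroup H) : Prop :=
  ∀ h ∈ K, ∀ f : Schwartz X, ξ (Schwartz.translate h f) = ξ f

end Distributions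

section Space

variable (F : Type*) [Field F] (ι : Type*)

/-- `V ⊕ V*` for `V = F^ι`: pairs of a column vector `v` and a row vector `φ`. -/
abbrev VVStar : Type _ := (ι → F) × (ι → F)

variable {F ι} [Fintype ι]

/-- The symmetric bilinear form `B` on `V ⊕ V*` with `B (x, x) = Q x`, where
`Q (v, φ) = φ v`. -/
def form (x y : VVStar F ι) : F := (x.2 ⬝ᵥ y.1 + y.2 ⬝ᵥ x.1) / 2

theorem form_add_left (x x' y : VVStar F ι) : form (x + x') y = form x y + form x' y := by
  simp [form, add_dotProduct, dotProduct_add]; ring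

theorem form_comm (x y : VVStar F ι) : form x y = form y x := by
  simp [form, add_comm]

theorem form_add_right (x y y' : VVStar F ι) : form x (y + y') = form x y + form x y' := by
  rw [form_comm, form_add_left, form_comm y, form_comm y']

end Space

section Lattices

variable {F : Type*} [Field F] [ValuativeRel F] {ι : Type*}

/-- The lattice of all vectors whose coordinates have valuation at most `γ`. -/
def box (F ι : Type*) [Field F] [ValuativeRel F] (γ : ValueGroupWithZero F) :
    Set (VVStar F ι) :=
  {x | (∀ i, valuation F (x.1 i) ≤ γ) ∧ ∀ i, valuation F (x.2 i) ≤ γ}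

theorem box_eq (γ : ValueGroupWithZero F) : box F ι γ =
    (Set.univ.pi fun _ => {z | valuation F z ≤ γ}) ×ˢ
      (Set.univ.pi fun _ => {z | valuation F z ≤ γ}) := by
  ext x; simp [box]

theorem box_mono {γ δ : ValueGroupWithZero F} (h : γ ≤ δ) : box F ι γ ⊆ box F ι δ :=
  fun _ hx => ⟨fun i => (hx.1 i).trans h, fun i => (hx.2 i).trans h⟩

theorem box_zero_mem (γ : ValueGroupWithZero F) : (0 : VVStar F ι) ∈ box F ι γ := by
  simp [box]

theorem box_add {γ : ValueGroupWithZero F} {x y : VVStar F ι} (hx : x ∈ box F ι γ)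
    (hy : y ∈ box F ι γ) : x + y ∈ box F ι γ :=
  ⟨fun i => Valuation.map_add_le _ (hx.1 i) (hy.1 i),
    fun i => Valuation.map_add_le _ (hx.2 i) (hy.2 i)⟩

theorem box_neg {γ : ValueGroupWithZero F} {x : VVStar F ι} (hx : x ∈ box F ι γ) :
    -x ∈ box F ι γ := by
  simpa [box] using hx

theorem min_ne_zero {γ δ : ValueGroupWithZero F} (hγ : γ ≠ 0) (hδ : δ ≠ 0) : min γ δ ≠ 0 := by
  rcases min_choice γ δ with h | h <;> rw [h] <;> assumption

theorem max_ne_zero {γ δ : ValueGroupWithZero F} (hγ : γ ≠ 0) (hδ : δ ≠ 0) : max γ δ ≠ 0 := by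
  rcases max_choice γ δ with h | h <;> rw [h] <;> assumption

variable [TopologicalSpace F] [IsNonarchimedeanLocalField F]

theorem ball_open {γ : ValueGroupWithZero F} (hγ : γ ≠ 0) :
    IsOpen {z : F | valuation F z ≤ γ} := by
  rw [isOpen_iff_mem_nhds]
  intro x hx
  rw [IsValuativeTopology.mem_nhds_iff']
  refine ⟨Units.mk0 γ hγ, fun z hz => ?_⟩
  have h := Valuation.map_add_le (valuation F) (x := z - x) (y := x) (le_of_lt hz) hx
  simpa using h

theorem box_open [Finite ι] {γ : ValueGroupWithZero F} (hγ : γ ≠ 0) : IsOpen (box F ι γ) := by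
  rw [box_eq]
  exact (isOpen_set_pi Set.finite_univ fun _ _ => ball_open hγ).prod
    (isOpen_set_pi Set.finite_univ fun _ _ => ball_open hγ)

theorem box_compact (γ : ValueGroupWithZero F) : IsCompact (box F ι γ) := by
  rw [box_eq]
  exact (isCompact_univ_pi fun _ => IsNonarchimedeanLocalField.isCompact_closedBall F γ).prod
    (isCompact_univ_pi fun _ => IsNonarchimedeanLocalField.isCompact_closedBall F γ)

theorem box_closed [Finite ι] {γ : ValueGroupWithZero F} (hγ : γ ≠ 0) :
    IsClosed (box F ι γ) := by
  let G : AddSubgroup (VVStar F ι) :=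
    { carrier := box F ι γ, add_mem' := box_add, zero_mem' := box_zero_mem γ, neg_mem' := box_neg }
  exact G.isClosed_of_isOpen (box_open hγ)

theorem ball_basis {U : Set F} (hU : U ∈ 𝓝 (0 : F)) :
    ∃ γ : ValueGroupWithZero F, γ ≠ 0 ∧ {z : F | valuation F z ≤ γ} ⊆ U := by
  obtain ⟨γ, hγ⟩ := (IsValuativeTopology.mem_nhds_zero_iff U).1 hU
  obtain ⟨δ, hδ, hlt⟩ := Valuation.IsNontrivial.exists_lt_one (v := valuation F)
  refine ⟨γ * valuation F δ, by simpa using hδ, fun z hz => hγ ?_⟩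
  refine lt_of_le_of_lt (show valuation F z ≤ _ from hz) ?_
  simpa using mul_lt_mul_of_pos_left hlt (zero_lt_iff.2 γ.ne_zero)

theorem pi_basis [Finite ι] {U : Set (ι → F)} (hU : U ∈ 𝓝 (0 : ι → F)) :
    ∃ γ : ValueGroupWithZero F, γ ≠ 0 ∧ {z : ι → F | ∀ i, valuation F (z i) ≤ γ} ⊆ U := by
  cases nonempty_fintype ι
  rw [nhds_pi, Filter.mem_pi'] at hU
  obtain ⟨I, t, ht, hsub⟩ := hU
  choose γ hγ hγt using fun i => ball_basis (ht i)
  have : ∀ s : Finset ι, ∃ δ : ValueGroupWithZero F, δ ≠ 0 ∧ ∀ i ∈ s, δ ≤ γ i := by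
    intro s
    induction s using Finset.cons_induction with
    | empty => exact ⟨1, one_ne_zero, by simp⟩
    | cons a s ha ih =>
      obtain ⟨δ, h0, h⟩ := ih
      refine ⟨min δ (γ a), min_ne_zero h0 (hγ a), fun i hi => ?_⟩
      rcases Finset.mem_cons.1 hi with rfl | hi
      · exact min_le_right _ _
      · exact (min_le_left _ _).trans (h i hi)
  obtain ⟨δ, h0, h⟩ := this I
  exact ⟨δ, h0, fun z hz => hsub fun i hi => hγt i ((hz i).trans (h i hi))⟩

theorem box_basis [Finite ι] {U : Set (VVStar F ι)} (hU : U ∈ 𝓝 (0 : VVStar F ι)) :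
    ∃ γ : ValueGroupWithZero F, γ ≠ 0 ∧ box F ι γ ⊆ U := by
  rw [show (0 : VVStar F ι) = (0, 0) from rfl, nhds_prod_eq, Filter.mem_prod_iff] at hU
  obtain ⟨U₁, h₁, U₂, h₂, hsub⟩ := hU
  obtain ⟨γ, hγ, h₁⟩ := pi_basis h₁
  obtain ⟨δ, hδ, h₂⟩ := pi_basis h₂
  exact ⟨min γ δ, min_ne_zero hγ hδ, fun x hx => hsub
    ⟨h₁ fun i => (hx.1 i).trans (min_le_left _ _), h₂ fun i => (hx.2 i).trans (min_le_right _ _)⟩⟩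

theorem box_exhaust [Finite ι] {K : Set (VVStar F ι)} (hK : IsCompact K) :
    ∃ γ : ValueGroupWithZero F, γ ≠ 0 ∧ K ⊆ box F ι γ := by
  refine hK.induction_on (p := fun s => ∃ γ : ValueGroupWithZero F, γ ≠ 0 ∧ s ⊆ box F ι γ)
    ⟨1, one_ne_zero, Set.empty_subset _⟩ (fun s t hst ⟨γ, h, ht⟩ => ⟨γ, h, hst.trans ht⟩) ?_ ?_
  · rintro s t ⟨γ, hγ, hs⟩ ⟨δ, hδ, ht⟩
    exact ⟨max γ δ, max_ne_zero hγ hδ, Set.union_subset (hs.trans (box_mono (le_max_left _ _)))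
      (ht.trans (box_mono (le_max_right _ _)))⟩
  · intro x _
    cases nonempty_fintype ι
    let γ : ValueGroupWithZero F := max 1 (Finset.univ.sup fun i =>
      max (valuation F (x.1 i)) (valuation F (x.2 i)))
    have hγ : γ ≠ 0 := (lt_of_lt_of_le zero_lt_one (le_max_left _ _)).ne'
    have hle (i : ι) : max (valuation F (x.1 i)) (valuation F (x.2 i)) ≤ γ :=
      le_trans (Finset.le_sup (f := fun i => max (valuation F (x.1 i)) (valuation F (x.2 i)))
        (Finset.mem_univ i)) (le_max_right _ _)
    exact ⟨box F ι γ, mem_nhdsWithin_of_mem_nhds ((box_open hγ).mem_nhds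
      ⟨fun i => (le_max_left _ _).trans (hle i), fun i => (le_max_right _ _).trans (hle i)⟩),
      γ, hγ, subset_rfl⟩

/-- A Schwartz function is invariant under translations by a small lattice. -/
theorem Schwartz.exists_box_invariant [Finite ι] (f : Schwartz (VVStar F ι)) :
    ∃ γ : ValueGroupWithZero F, γ ≠ 0 ∧ ∀ h ∈ box F ι γ, ∀ x,
      (f : VVStar F ι → ℂ) (x + h) = (f : VVStar F ι → ℂ) x := by
  obtain ⟨γ, hγ, H⟩ : ∃ γ : ValueGroupWithZero F, γ ≠ 0 ∧ ∀ x ∈ tsupport (f : VVStar F ι → ℂ),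
      ∀ h ∈ box F ι γ, (f : VVStar F ι → ℂ) (x + h) = (f : VVStar F ι → ℂ) x := by
    refine f.2.2.isCompact.induction_on (p := fun s => ∃ γ : ValueGroupWithZero F, γ ≠ 0 ∧ ∀ x ∈ s,
      ∀ h ∈ box F ι γ, (f : VVStar F ι → ℂ) (x + h) = (f : VVStar F ι → ℂ) x)
      ⟨1, one_ne_zero, by simp⟩ (fun s t hst ⟨γ, h, ht⟩ => ⟨γ, h, fun x hx => ht x (hst hx)⟩) ?_ ?_
    · rintro s t ⟨γ, hγ, hs⟩ ⟨δ, hδ, ht⟩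
      refine ⟨min γ δ, min_ne_zero hγ hδ, fun x hx h hh => ?_⟩
      rcases hx with hx | hx
      · exact hs x hx h (box_mono (min_le_left _ _) hh)
      · exact ht x hx h (box_mono (min_le_right _ _) hh)
    · intro x _
      have h1 : {h : VVStar F ι | (f : VVStar F ι → ℂ) (x + h) = (f : VVStar F ι → ℂ) x} ∈ 𝓝 0 := by
        have := (IsLocallyConstant.iff_eventually_eq _).1 f.2.1 x
        have ht : Filter.Tendsto (fun h : VVStar F ι => x + h) (𝓝 0) (𝓝 x) := by
          have hcont : Continuous fun h : VVStar F ι => x + h := by fun_prop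
          simpa using hcont.tendsto 0
        exact ht.eventually this
      obtain ⟨γ, hγ, hsub⟩ := box_basis h1
      refine ⟨(fun y => y - x) ⁻¹' box F ι γ, mem_nhdsWithin_of_mem_nhds
        (((box_open hγ).preimage (by fun_prop)).mem_nhds (by simp [box_zero_mem])), γ, hγ, ?_⟩
      intro y hy h hh
      have e1 := hsub hy
      have e2 := hsub (box_add hy hh)
      simp only [Set.mem_ofPred_eq] at e1 e2
      rw [show x + (y - x) = y by abel] at e1
      rw [show x + (y - x + h) = y + h by abel] at e2
      rw [e1, e2]
  refine ⟨γ, hγ, fun h hh x => ?_⟩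
  by_cases hx : x ∈ tsupport (f : VVStar F ι → ℂ)
  · exact H x hx h hh
  by_cases hy : x + h ∈ tsupport (f : VVStar F ι → ℂ)
  · simpa using (H _ hy _ (box_neg hh)).symm
  · rw [image_eq_zero_of_notMem_tsupport hx, image_eq_zero_of_notMem_tsupport hy]

end Lattices

section Fourier

variable {F : Type*} [Field F] {ι : Type*} [Fintype ι]

/-- The Fourier integral `y ↦ ∫ ψ(B(x, y)) f(x) dμ(x)` on `V ⊕ V*`. -/
noncomputable def fourierFun (ψ : AddChar F Circle)
    {m : MeasurableSpace (VVStar F ι)}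
    (μ : Measure (VVStar F ι)) (f : VVStar F ι → ℂ) (y : VVStar F ι) : ℂ :=
  ∫ x, (ψ (form x y) : ℂ) * f x ∂μ

theorem char_form_add_right (ψ : AddChar F Circle) (x y h : VVStar F ι) :
    (ψ (form x (y + h)) : ℂ) = (ψ (form x y) : ℂ) * (ψ (form x h) : ℂ) := by
  rw [form_add_right, AddChar.map_add_eq_mul, Circle.coe_mul]

theorem char_form_add_left (ψ : AddChar F Circle) (x h y : VVStar F ι) :
    (ψ (form (x + h) y) : ℂ) = (ψ (form x y) : ℂ) * (ψ (form h y) : ℂ) := by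
  rw [form_add_left, AddChar.map_add_eq_mul, Circle.coe_mul]

theorem form_continuous [TopologicalSpace F] [IsTopologicalRing F] :
    Continuous fun p : VVStar F ι × VVStar F ι => form p.1 p.2 := by
  simp only [form, dotProduct, div_eq_mul_inv]
  fun_prop

theorem char_form_continuous [TopologicalSpace F] [IsTopologicalRing F] {ψ : AddChar F Circle}
    (hψ : Continuous ψ) :
    Continuous fun p : VVStar F ι × VVStar F ι => (ψ (form p.1 p.2) : ℂ) :=
  continuous_induced_dom.comp (hψ.comp form_continuous)

variable [ValuativeRel F] [TopologicalSpace F] [IsNonarchimedeanLocalField F]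

theorem char_trivial_near_zero {ψ : AddChar F Circle} (hψ : Continuous ψ) :
    ∃ γ : ValueGroupWithZero F, γ ≠ 0 ∧ ∀ z, valuation F z ≤ γ → ψ z = 1 := by
  have hU : {z : F | ‖(ψ z : ℂ) - 1‖ < 1 / 2} ∈ 𝓝 (0 : F) := by
    have hc : Continuous fun z : F => ‖(ψ z : ℂ) - 1‖ :=
      ((continuous_induced_dom.comp hψ).sub continuous_const).norm
    exact (isOpen_lt hc continuous_const).mem_nhds (by simp)
  obtain ⟨γ, hγ, hsub⟩ := ball_basis hU
  refine ⟨γ, hγ, fun z hz => ?_⟩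
  have hball (n : ℕ) : valuation F ((2 : F) ^ n * z) ≤ γ := by
    have h2 : valuation F (2 : F) ≤ 1 := by
      rw [← one_add_one_eq_two]
      exact Valuation.map_add_le _ (by simp) (by simp)
    rw [map_mul, map_pow]
    exact (mul_le_of_le_one_left' (pow_le_one' h2 n)).trans hz
  have hgrow (n : ℕ) : (3 / 2 : ℝ) ^ n * ‖(ψ z : ℂ) - 1‖ ≤ ‖(ψ ((2 : F) ^ n * z) : ℂ) - 1‖ := by
    induction n with
    | zero => simp
    | succ n ih =>
      set w : ℂ := (ψ ((2 : F) ^ n * z) : ℂ) with hw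
      have e : (ψ ((2 : F) ^ (n + 1) * z) : ℂ) = w * w := by
        rw [hw, ← Circle.coe_mul, ← AddChar.map_add_eq_mul]; congr 2; ring
      have h1 : ‖w - 1‖ < 1 / 2 := hsub (hball n)
      have h2 : (3 / 2 : ℝ) ≤ ‖w + 1‖ := by
        have h3 : ‖(2 : ℂ)‖ ≤ ‖w + 1‖ + ‖w - 1‖ := by
          have := norm_sub_le (w + 1) (w - 1)
          rwa [show w + 1 - (w - 1) = 2 by ring] at this
        norm_num at h3
        linarith
      rw [e, show w * w - 1 = (w + 1) * (w - 1) by ring, norm_mul, pow_succ']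
      calc 3 / 2 * (3 / 2 : ℝ) ^ n * ‖(ψ z : ℂ) - 1‖
          = 3 / 2 * ((3 / 2 : ℝ) ^ n * ‖(ψ z : ℂ) - 1‖) := by ring
        _ ≤ ‖w + 1‖ * ‖w - 1‖ := by gcongr
  by_contra hne
  have hpos : 0 < ‖(ψ z : ℂ) - 1‖ := by
    rw [norm_pos_iff, sub_ne_zero]
    exact fun h => hne (Circle.coe_eq_one.1 h)
  obtain ⟨n, hn⟩ := pow_unbounded_of_one_lt (1 / ‖(ψ z : ℂ) - 1‖) (by norm_num : (1 : ℝ) < 3 / 2)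
  rw [div_lt_iff₀ hpos] at hn
  have := hsub (hball n)
  simp only [Set.mem_ofPred_eq] at this
  linarith [hgrow n]

theorem dot_le {γ δ : ValueGroupWithZero F} {a b : ι → F} (ha : ∀ i, valuation F (a i) ≤ γ)
    (hb : ∀ i, valuation F (b i) ≤ δ) : valuation F (a ⬝ᵥ b) ≤ γ * δ :=
  Valuation.map_sum_le _ fun i _ => by
    rw [map_mul]; exact mul_le_mul' (ha i) (hb i)

variable [CharZero F]

theorem char_form_trivial {ψ : AddChar F Circle} (hψ : Continuous ψ) :
    ∃ d : ValueGroupWithZero F, d ≠ 0 ∧ ∀ γ δ, γ * δ ≤ d → ∀ x ∈ box F ι γ, ∀ y ∈ box F ι δ,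
      ψ (form x y) = 1 := by
  obtain ⟨γ₀, h0, H⟩ := char_trivial_near_zero hψ
  have h2 : valuation F (2 : F) ≠ 0 := by simp
  refine ⟨γ₀ * valuation F 2, mul_ne_zero h0 h2, fun γ δ hγδ x hx y hy => H _ ?_⟩
  rw [form, map_div₀, div_le_iff₀ (zero_lt_iff.2 h2)]
  refine le_trans (Valuation.map_add_le _ (dot_le hx.2 hy.1) ?_) hγδ
  rw [mul_comm γ]
  exact dot_le hy.2 hx.1

theorem annihilator_box {ψ : AddChar F Circle} (hψ : ψ ≠ 1) :
    ∃ c : ValueGroupWithZero F, c ≠ 0 ∧ ∀ γ : ValueGroupWithZero F, γ ≠ 0 → ∀ y : VVStar F ι,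
      (∀ x ∈ box F ι γ, ψ (form x y) = 1) → y ∈ box F ι (c / γ) := by
  classical
  obtain ⟨a, ha⟩ := AddChar.ne_one_iff.1 hψ
  have ha0 : a ≠ 0 := by rintro rfl; simp at ha
  refine ⟨valuation F (2 * a), by simpa using ha0, fun γ hγ y hy => ?_⟩
  have key (b : F) (hb : ∀ t : F, valuation F t ≤ γ → ψ (t * b / 2) = 1) :
      valuation F b ≤ valuation F (2 * a) / γ := by
    by_contra! hlt
    have hb0 : b ≠ 0 := by rintro rfl; simp at hlt
    refine ha ?_
    have := hb (2 * a / b) (by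
      rw [div_lt_iff₀ (zero_lt_iff.2 hγ)] at hlt
      rw [map_div₀, div_le_iff₀ (by simpa [zero_lt_iff] using hb0), mul_comm]
      simpa [mul_comm] using hlt.le)
    rwa [div_mul_cancel₀ _ hb0, mul_div_cancel_left₀ _ two_ne_zero] at this
  have hs (i : ι) (t : F) (ht : valuation F t ≤ γ) (j : ι) :
      valuation F ((Pi.single i t : ι → F) j) ≤ γ := by
    by_cases h : j = i
    · subst h; simpa using ht
    · simp [Pi.single_eq_of_ne h]
  refine ⟨fun i => key _ fun t ht => ?_, fun i => key _ fun t ht => ?_⟩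
  · simpa [form] using hy (0, Pi.single i t) ⟨by simp, hs i t ht⟩
  · have := hy (Pi.single i t, 0) ⟨hs i t ht, by simp⟩
    simpa [form, mul_comm] using this

variable [MeasurableSpace (VVStar F ι)] [BorelSpace (VVStar F ι)]
  {μ : Measure (VVStar F ι)} [μ.IsAddHaarMeasure] {ψ : AddChar F Circle}

theorem fourier_integrable (hψ : Continuous ψ) (f : Schwartz (VVStar F ι)) (y : VVStar F ι) :
    Integrable (fun x => (ψ (form x y) : ℂ) * (f : VVStar F ι → ℂ) x) μ := by
  have h1 : Continuous fun x : VVStar F ι => (ψ (form x y) : ℂ) :=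
    (char_form_continuous hψ).comp (continuous_id.prodMk continuous_const)
  exact (h1.mul f.2.1.continuous).integrable_of_hasCompactSupport f.2.2.mul_left

theorem fourierFun_char_mul (f : VVStar F ι → ℂ) (y h : VVStar F ι)
    (hf : ∀ x, f (x + h) = f x) :
    fourierFun ψ μ f y = (ψ (form h y) : ℂ) * fourierFun ψ μ f y := by
  conv_lhs => rw [fourierFun, ← integral_add_right_eq_self _ h]
  rw [fourierFun, ← integral_const_mul]
  congr 1; ext x
  rw [char_form_add_left, hf]; ring

theorem fourierFun_eq_zero {f : VVStar F ι → ℂ} {y h : VVStar F ι}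
    (hf : ∀ x, f (x + h) = f x) (hne : ψ (form h y) ≠ 1) : fourierFun ψ μ f y = 0 := by
  have := fourierFun_char_mul (μ := μ) (ψ := ψ) f y h hf
  by_contra h0
  refine hne (Circle.coe_eq_one.1 ?_)
  exact (mul_right_cancel₀ h0 (by rw [one_mul]; exact this)).symm

theorem fourierFun_mem (hψ : Continuous ψ) (hψ1 : ψ ≠ 1) (f : Schwartz (VVStar F ι)) :
    fourierFun ψ μ f ∈ Schwartz (VVStar F ι) := by
  constructor
  · obtain ⟨γ, hγ, hsub⟩ := box_exhaust f.2.2.isCompact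
    obtain ⟨d, hd, H⟩ := char_form_trivial (ι := ι) hψ
    have hd' : d / γ ≠ 0 := div_ne_zero hd hγ
    rw [IsLocallyConstant.iff_exists_open]
    refine fun y => ⟨(fun z => z - y) ⁻¹' box F ι (d / γ), (box_open hd').preimage (by fun_prop),
      by simp [box_zero_mem], fun z hz => ?_⟩
    unfold fourierFun
    congr 1; ext x
    by_cases hx : x ∈ tsupport (f : VVStar F ι → ℂ)
    · have := H γ (d / γ) (by rw [mul_div_cancel₀ _ hγ]) x (hsub hx) _ hz
      conv_lhs => rw [show z = y + (z - y) by abel, char_form_add_right, this]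
      simp
    · rw [image_eq_zero_of_notMem_tsupport hx]; simp
  · obtain ⟨γ, hγ, hinv⟩ := Schwartz.exists_box_invariant f
    obtain ⟨c, hc, H⟩ := annihilator_box (ι := ι) hψ1
    refine HasCompactSupport.of_support_subset_isCompact (box_compact (c / γ)) fun y hy => ?_
    refine H γ hγ y fun x hx => ?_
    by_contra hne
    exact hy (fourierFun_eq_zero (hinv x hx) hne)

/-- The indicator function of a lattice. -/
noncomputable def boxInd (F ι : Type*) [Field F] [ValuativeRel F] [TopologicalSpace F]
    [IsNonarchimedeanLocalField F] [Finite ι] (γ : ValueGroupWithZero F) (hγ : γ ≠ 0) :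
    Schwartz (VVStar F ι) :=
  ⟨(box F ι γ).indicator 1, by
      rw [IsLocallyConstant.iff_exists_open]
      intro x
      by_cases hx : x ∈ box F ι γ
      · exact ⟨_, box_open hγ, hx, fun y hy => by simp [hx, hy]⟩
      · exact ⟨_, (box_closed hγ).isOpen_compl, hx, fun y hy => by
          simp [hx, show y ∉ box F ι γ from hy]⟩,
    HasCompactSupport.of_support_subset_isCompact (box_compact γ) Set.support_indicator_subset⟩

theorem boxInd_add {γ : ValueGroupWithZero F} (hγ : γ ≠ 0) {h : VVStar F ι} (hh : h ∈ box F ι γ)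
    (x : VVStar F ι) : (boxInd F ι γ hγ : VVStar F ι → ℂ) (x + h) = (boxInd F ι γ hγ : _ → ℂ) x := by
  have : x + h ∈ box F ι γ ↔ x ∈ box F ι γ :=
    ⟨fun hx => by simpa using box_add hx (box_neg hh), fun hx => box_add hx hh⟩
  by_cases hx : x ∈ box F ι γ
  · simp [boxInd, hx, this.2 hx]
  · simp [boxInd, hx, this.not.2 hx]

theorem fourierFun_fourierFun (hψ : Continuous ψ) (hψ1 : ψ ≠ 1) (f : Schwartz (VVStar F ι)) :
    ∃ γ₀ : ValueGroupWithZero F, ∀ γ (hγ : γ ≠ 0), γ₀ ≤ γ → ∀ z,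
      fourierFun ψ μ (fourierFun ψ μ f) z =
        (f : VVStar F ι → ℂ) (-z) * ∫ x, fourierFun ψ μ (boxInd F ι γ hγ) x ∂μ := by
  obtain ⟨γ₁, hγ₁, hsub⟩ := box_exhaust (fourierFun_mem (μ := μ) hψ hψ1 f).2.isCompact
  obtain ⟨δ, hδ, hinv⟩ := Schwartz.exists_box_invariant f
  obtain ⟨c, hc, H⟩ := annihilator_box (ι := ι) hψ1
  refine ⟨max γ₁ (c / δ), fun γ hγ hle z => ?_⟩
  set D := fourierFun ψ μ (boxInd F ι γ hγ) with hD
  have hsupp (y : VVStar F ι) (hy : D y ≠ 0) : y ∈ box F ι δ := by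
    have h1 : c / γ ≤ δ := by
      have h2 := (le_max_right _ _).trans hle
      rw [div_le_iff₀ (zero_lt_iff.2 hδ)] at h2
      rwa [div_le_iff₀ (zero_lt_iff.2 hγ), mul_comm]
    refine box_mono h1 (H γ hγ y fun x hx => ?_)
    by_contra hne
    exact hy (fourierFun_eq_zero (boxInd_add hγ hx) hne)
  let G : VVStar F ι → VVStar F ι → ℂ := fun y x =>
    (boxInd F ι γ hγ : VVStar F ι → ℂ) y *
      ((ψ (form y z) : ℂ) * ((ψ (form x y) : ℂ) * (f : VVStar F ι → ℂ) x))
  have hGc : Continuous G.uncurry := by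
    have c1 : Continuous fun p : VVStar F ι × VVStar F ι => (ψ (form p.1 z) : ℂ) :=
      (char_form_continuous hψ).comp (continuous_fst.prodMk continuous_const)
    have c2 : Continuous fun p : VVStar F ι × VVStar F ι => (ψ (form p.2 p.1) : ℂ) :=
      (char_form_continuous hψ).comp (continuous_snd.prodMk continuous_fst)
    exact ((boxInd F ι γ hγ).2.1.continuous.comp continuous_fst).mul
      (c1.mul (c2.mul (f.2.1.continuous.comp continuous_snd)))
  have hGs : HasCompactSupport G.uncurry := by
    refine HasCompactSupport.of_support_subset_isCompact
      ((box_compact γ).prod f.2.2.isCompact) fun p hp => ⟨?_, ?_⟩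
    · by_contra h
      exact hp (by simp [G, Function.uncurry, boxInd, h])
    · by_contra h
      exact hp (by simp [G, Function.uncurry, image_eq_zero_of_notMem_tsupport h])
  have e1 : fourierFun ψ μ (fourierFun ψ μ f) z = ∫ y, ∫ x, G y x ∂μ ∂μ := by
    rw [fourierFun]
    congr 1; ext y
    simp only [G, integral_const_mul]
    by_cases hy : y ∈ box F ι γ
    · simp [boxInd, hy, fourierFun]
    · have : fourierFun ψ μ f y = 0 :=
        image_eq_zero_of_notMem_tsupport fun h => hy
          (box_mono ((le_max_left _ _).trans hle) (hsub h))
      simp [boxInd, hy, this]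
  have e2 (x : VVStar F ι) : ∫ y, G y x ∂μ = (f : VVStar F ι → ℂ) (-z) * D (x + z) := by
    have : ∫ y, G y x ∂μ = (f : VVStar F ι → ℂ) x * D (x + z) := by
      rw [hD, fourierFun, ← integral_const_mul]
      congr 1; ext y
      simp only [G]
      rw [char_form_add_right, form_comm x y]; ring
    rw [this]
    by_cases h0 : D (x + z) = 0
    · simp [h0]
    · have := hinv _ (hsupp _ h0) (-z)
      rw [show -z + (x + z) = x by abel] at this
      rw [this]
  rw [e1, integral_integral_swap_of_hasCompactSupport hGc hGs]
  simp only [e2]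
  rw [integral_const_mul, integral_add_right_eq_self D z]

theorem exists_inversion_constant (hψ : Continuous ψ) (hψ1 : ψ ≠ 1) :
    ∃ c : ℝ, 0 < c ∧ ∀ (f : Schwartz (VVStar F ι)) (z : VVStar F ι),
      fourierFun ψ μ (fourierFun ψ μ f) z = c * (f : VVStar F ι → ℂ) (-z) := by
  obtain ⟨γ₀, H⟩ := fourierFun_fourierFun (μ := μ) hψ hψ1 (boxInd F ι 1 one_ne_zero)
  have hg : max γ₀ 1 ≠ 0 := (lt_of_lt_of_le zero_lt_one (le_max_right γ₀ 1)).ne'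
  set I : ℂ := ∫ x, fourierFun ψ μ (boxInd F ι (max γ₀ 1) hg) x ∂μ with hI
  have hconst (γ) (hγ : γ ≠ 0) (hle : γ₀ ≤ γ) :
      ∫ x, fourierFun ψ μ (boxInd F ι γ hγ) x ∂μ = I := by
    have h1 := H γ hγ hle 0
    have h2 := H _ hg (le_max_left _ _) 0
    rw [h1] at h2
    rw [← hI] at h2
    simpa [show (boxInd F ι 1 one_ne_zero : VVStar F ι → ℂ) 0 = 1 by
      simp [boxInd, box_zero_mem]] using h2
  have hval (x : VVStar F ι) : fourierFun ψ μ (boxInd F ι (max γ₀ 1) hg) x =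
      (((fourierFun ψ μ (boxInd F ι (max γ₀ 1) hg) x).re : ℝ) : ℂ) ∧
      0 ≤ (fourierFun ψ μ (boxInd F ι (max γ₀ 1) hg) x).re := by
    by_cases hx : ∀ h ∈ box F ι (max γ₀ 1), ψ (form h x) = 1
    · have : fourierFun ψ μ (boxInd F ι (max γ₀ 1) hg) x = (μ.real (box F ι (max γ₀ 1)) : ℂ) := by
        rw [fourierFun, show (fun y => (ψ (form y x) : ℂ) *
          (boxInd F ι (max γ₀ 1) hg : VVStar F ι → ℂ) y) =
            (box F ι (max γ₀ 1)).indicator (fun _ => (1 : ℂ)) from ?_]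
        · rw [integral_indicator (box_open hg).measurableSet]; simp
        · ext y
          by_cases hy : y ∈ box F ι (max γ₀ 1)
          · simp [boxInd, hy, hx y hy]
          · simp [boxInd, hy]
      rw [this]
      simp
    · push Not at hx
      obtain ⟨h, hh, hne⟩ := hx
      rw [fourierFun_eq_zero (boxInd_add hg hh) hne]
      simp
  have hS := fourierFun_mem (μ := μ) hψ hψ1 (boxInd F ι (max γ₀ 1) hg)
  set D : VVStar F ι → ℂ := fourierFun ψ μ (boxInd F ι (max γ₀ 1) hg)
  have hpos : 0 < ∫ x, (D x).re ∂μ := by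
    refine Continuous.integral_pos_of_hasCompactSupport_nonneg_nonzero (x := 0)
      (Complex.continuous_re.comp hS.1.continuous)
      (hS.2.comp_left (g := Complex.re) rfl) (fun x => (hval x).2) fun h0 => ?_
    have h1 : D 0 = 0 := by rw [(hval 0).1]; simpa using h0
    have h2 : D 0 = (μ.real (box F ι (max γ₀ 1)) : ℂ) := by
      simp only [D, fourierFun]
      rw [show (fun y : VVStar F ι => (ψ (form y 0) : ℂ) *
          (boxInd F ι (max γ₀ 1) hg : VVStar F ι → ℂ) y) =
            (box F ι (max γ₀ 1)).indicator (fun _ => (1 : ℂ)) from ?_]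
      · rw [integral_indicator (box_open hg).measurableSet]; simp
      · ext y
        by_cases hy : y ∈ box F ι (max γ₀ 1) <;> simp [boxInd, hy, form]
    rw [h1] at h2
    have h3 : μ.real (box F ι (max γ₀ 1)) = 0 := by exact_mod_cast h2.symm
    have h4 : 0 < μ.real (box F ι (max γ₀ 1)) :=
      ENNReal.toReal_pos ((box_open hg).measure_pos μ ⟨0, box_zero_mem _⟩).ne'
        (box_compact _).measure_lt_top.ne
    exact h4.ne' h3
  have hIre : I = ((∫ x, (D x).re ∂μ : ℝ) : ℂ) := by
    rw [hI, ← integral_complex_ofReal]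
    exact integral_congr_ae (.of_forall fun x => (hval x).1)
  refine ⟨_, hpos, fun f z => ?_⟩
  obtain ⟨γ₁, H₁⟩ := fourierFun_fourierFun (μ := μ) hψ hψ1 f
  have hg' : max γ₀ (max γ₁ 1) ≠ 0 :=
    (lt_of_lt_of_le zero_lt_one ((le_max_right γ₁ 1).trans (le_max_right _ _))).ne'
  rw [H₁ _ hg' ((le_max_left _ _).trans (le_max_right _ _)), hconst _ hg' (le_max_left _ _), hIre,
    mul_comm]

end Fourier

section SelfDual

variable {F : Type*} [Field F] [CharZero F] [ValuativeRel F] [TopologicalSpace F]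
  [IsNonarchimedeanLocalField F] {ι : Type*} [Fintype ι]

/-- A Haar measure on the Borel sets of `V ⊕ V*` is self-dual if Fourier inversion holds
without a constant. -/
structure IsSelfDual (ψ : AddChar F Circle) (μ : @Measure (VVStar F ι) (borel _)) : Prop where
  haar : @Measure.IsAddHaarMeasure _ _ _ (borel _) μ
  inversion : ∀ (f : Schwartz (VVStar F ι)) (z : VVStar F ι),
    fourierFun ψ μ (fourierFun ψ μ f) z = (f : VVStar F ι → ℂ) (-z)

theorem exists_isSelfDual {ψ : AddChar F Circle} (hψ : Continuous ψ) (hψ1 : ψ ≠ 1) :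
    ∃ μ : @Measure (VVStar F ι) (borel _), IsSelfDual ψ μ := by
  let : MeasurableSpace (VVStar F ι) := borel _
  have : BorelSpace (VVStar F ι) := ⟨rfl⟩
  obtain ⟨c, hc, H⟩ := exists_inversion_constant (μ := (Measure.addHaar : Measure (VVStar F ι)))
    hψ hψ1
  obtain ⟨s, hs⟩ : ∃ s : NNReal, (s : ℝ) * s * c = 1 := by
    refine ⟨Real.toNNReal (1 / √c), ?_⟩
    rw [Real.coe_toNNReal _ (by positivity), div_mul_div_comm, Real.mul_self_sqrt hc.le]
    field_simp
  have hs0 : s ≠ 0 := by rintro rfl; simp at hs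
  have hsmul (f : VVStar F ι → ℂ) : fourierFun ψ (s • (Measure.addHaar : Measure (VVStar F ι))) f =
      fun y => (s : ℂ) * fourierFun ψ Measure.addHaar f y := by
    ext y
    simp only [fourierFun]
    rw [integral_smul_nnreal_measure]
    rfl
  refine ⟨s • Measure.addHaar, ?_, fun f z => ?_⟩
  · exact Measure.IsAddHaarMeasure.nnreal_smul _ hs0
  · rw [hsmul, hsmul]
    have : fourierFun ψ (Measure.addHaar : Measure (VVStar F ι))
        (fun y => (s : ℂ) * fourierFun ψ Measure.addHaar f y) z =
        (s : ℂ) * fourierFun ψ Measure.addHaar (fourierFun ψ Measure.addHaar f) z := by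
      rw [fourierFun, fourierFun, ← integral_const_mul]
      congr 1; ext x; ring
    simp only [this, H]
    have hs' : (s : ℂ) * s * c = 1 := by exact_mod_cast hs
    linear_combination (f : VVStar F ι → ℂ) (-z) * hs'

variable (ι) in
/-- The self-dual measure on `V ⊕ V*` with respect to `ψ` and `form`. -/
noncomputable def selfDualMeasure {ψ : AddChar F Circle} (hψ : Continuous ψ) (hψ1 : ψ ≠ 1) :
    @Measure (VVStar F ι) (borel _) :=
  (exists_isSelfDual (ι := ι) hψ hψ1).choose

/-- The Fourier transform of Schwartz functions on `V ⊕ V*`. -/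
noncomputable def Schwartz.fourier {ψ : AddChar F Circle} (hψ : Continuous ψ) (hψ1 : ψ ≠ 1) :
    Schwartz (VVStar F ι) →ₗ[ℂ] Schwartz (VVStar F ι) :=
  letI : MeasurableSpace (VVStar F ι) := borel _
  haveI : BorelSpace (VVStar F ι) := ⟨rfl⟩
  haveI : (selfDualMeasure ι hψ hψ1).IsAddHaarMeasure :=
    (exists_isSelfDual (ι := ι) hψ hψ1).choose_spec.haar
  { toFun := fun f => ⟨fourierFun ψ (selfDualMeasure ι hψ hψ1) f, fourierFun_mem hψ hψ1 f⟩
    map_add' := fun f g => by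
      ext y
      simp only [fourierFun, Submodule.coe_add, Pi.add_apply, mul_add]
      exact integral_add (fourier_integrable hψ f y) (fourier_integrable hψ g y)
    map_smul' := fun c f => by
      ext y
      simp only [fourierFun, Submodule.coe_smul, Pi.smul_apply, smul_eq_mul, RingHom.id_apply]
      rw [← integral_const_mul]
      congr 1; ext x; ring }

/-- The Fourier transform of distributions, dual to that of Schwartz functions. -/
noncomputable def Distr.fourier {ψ : AddChar F Circle} (hψ : Continuous ψ) (hψ1 : ψ ≠ 1)
    (ξ : Distr (VVStar F ι)) : Distr (VVStar F ι) :=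
  ξ ∘ₗ Schwartz.fourier hψ hψ1

end SelfDual

section Group

variable (F : Type*) [Field F] (ι : Type*) [Fintype ι] [DecidableEq ι]

/-- The automorphism `g ↦ ᵗg⁻¹` of `GL(n, F)`. -/
def transposeInv : MulAut (GL ι F) where
  toFun g := ⟨((g⁻¹ : GL ι F) : Matrix ι ι F)ᵀ, (g : Matrix ι ι F)ᵀ,
    by rw [← transpose_mul, ← Units.val_mul]; simp, by rw [← transpose_mul, ← Units.val_mul]; simp⟩
  invFun g := ⟨((g⁻¹ : GL ι F) : Matrix ι ι F)ᵀ, (g : Matrix ι ι F)ᵀ,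
    by rw [← transpose_mul, ← Units.val_mul]; simp, by rw [← transpose_mul, ← Units.val_mul]; simp⟩
  left_inv g := Units.ext (transpose_transpose _)
  right_inv g := Units.ext (transpose_transpose _)
  map_mul' g h := Units.ext (by simp [transpose_mul])

/-- The action of the two element group, realised as `ℤˣ = {1, -1}`, on `GL(n, F)` by
`g ↦ ᵗg⁻¹`. -/
def signAction : ℤˣ →* MulAut (GL ι F) where
  toFun s := if s = 1 then 1 else transposeInv F ι
  map_one' := if_pos rfl
  map_mul' s t := by
    have h : transposeInv F ι * transposeInv F ι = 1 :=
      MulEquiv.ext fun g => Units.ext (transpose_transpose _)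
    rcases Int.units_eq_one_or s with rfl | rfl <;> rcases Int.units_eq_one_or t with rfl | rfl <;>
      simp [h]

/-- The group `G ⋊ S₂`; its elements are `g` and `g T` with `g ∈ G = GL(n, F)`, where `T` is the
generator of `S₂`. -/
abbrev GTilde : Type _ := GL ι F ⋊[signAction F ι] ℤˣ

variable {F ι}

/-- `G` acts on matrices by conjugation and `T` by transposition. -/
instance matrixAction : MulAction (GTilde F ι) (Matrix ι ι F) where
  smul x A := (x.left : Matrix ι ι F) * (if x.right = 1 then A else Aᵀ) *
    ((x.left⁻¹ : GL ι F) : Matrix ι ι F)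
  one_smul A := by
    change ((1 : GL ι F) : Matrix ι ι F) * (if (1 : ℤˣ) = 1 then A else Aᵀ) *
      (((1 : GL ι F)⁻¹ : GL ι F) : Matrix ι ι F) = A
    simp
  mul_smul x y A := by
    obtain ⟨g, s⟩ := x
    obtain ⟨h, t⟩ := y
    change ((g * signAction F ι s h : GL ι F) : Matrix ι ι F) * (if s * t = 1 then A else Aᵀ) *
        (((g * signAction F ι s h)⁻¹ : GL ι F) : Matrix ι ι F) =
      (g : Matrix ι ι F) * (if s = 1
        then (h : Matrix ι ι F) * (if t = 1 then A else Aᵀ) * ((h⁻¹ : GL ι F) : Matrix ι ι F)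
        else ((h : Matrix ι ι F) * (if t = 1 then A else Aᵀ) *
          ((h⁻¹ : GL ι F) : Matrix ι ι F))ᵀ) * ((g⁻¹ : GL ι F) : Matrix ι ι F)
    have h1 : ((transposeInv F ι h : GL ι F) : Matrix ι ι F) =
      ((h⁻¹ : GL ι F) : Matrix ι ι F)ᵀ := rfl
    have h2 : (((transposeInv F ι h)⁻¹ : GL ι F) : Matrix ι ι F) = (h : Matrix ι ι F)ᵀ := rfl
    rcases Int.units_eq_one_or s with rfl | rfl <;> rcases Int.units_eq_one_or t with rfl | rfl <;>
      simp only [signAction, MonoidHom.coe_mk, OneHom.coe_mk, if_true, mul_one, one_mul,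
        MulAut.one_apply, _root_.mul_inv_rev, Units.val_mul, transpose_mul, transpose_transpose,
        show ((-1 : ℤˣ) = 1) = False from by decide, show (-1 : ℤˣ) * -1 = 1 from by decide,
        if_false, h1, h2, Matrix.mul_assoc]

/-- `g (v, φ) = (g v, φ g⁻¹)` and `T (v, φ) = (ᵗφ, ᵗv)`. -/
instance vectorAction : MulAction (GTilde F ι) (VVStar F ι) where
  smul x p := ((x.left : Matrix ι ι F) *ᵥ (if x.right = 1 then p.1 else p.2),
    (if x.right = 1 then p.2 else p.1) ᵥ* ((x.left⁻¹ : GL ι F) : Matrix ι ι F))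
  one_smul p := by
    change (((1 : GL ι F) : Matrix ι ι F) *ᵥ (if (1 : ℤˣ) = 1 then p.1 else p.2),
      (if (1 : ℤˣ) = 1 then p.2 else p.1) ᵥ* (((1 : GL ι F)⁻¹ : GL ι F) : Matrix ι ι F)) = p
    simp
  mul_smul x y p := by
    obtain ⟨g, s⟩ := x
    obtain ⟨h, t⟩ := y
    obtain ⟨v, w⟩ := p
    change (((g * signAction F ι s h : GL ι F) : Matrix ι ι F) *ᵥ (if s * t = 1 then v else w),
        (if s * t = 1 then w else v) ᵥ*
          (((g * signAction F ι s h)⁻¹ : GL ι F) : Matrix ι ι F)) =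
      ((g : Matrix ι ι F) *ᵥ (if s = 1 then (h : Matrix ι ι F) *ᵥ (if t = 1 then v else w)
          else (if t = 1 then w else v) ᵥ* ((h⁻¹ : GL ι F) : Matrix ι ι F)),
        (if s = 1 then (if t = 1 then w else v) ᵥ* ((h⁻¹ : GL ι F) : Matrix ι ι F)
          else (h : Matrix ι ι F) *ᵥ (if t = 1 then v else w)) ᵥ*
            ((g⁻¹ : GL ι F) : Matrix ι ι F))
    have h1 : ((transposeInv F ι h : GL ι F) : Matrix ι ι F) =
      ((h⁻¹ : GL ι F) : Matrix ι ι F)ᵀ := rfl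
    have h2 : (((transposeInv F ι h)⁻¹ : GL ι F) : Matrix ι ι F) = (h : Matrix ι ι F)ᵀ := rfl
    rcases Int.units_eq_one_or s with rfl | rfl <;> rcases Int.units_eq_one_or t with rfl | rfl <;>
      simp only [signAction, MonoidHom.coe_mk, OneHom.coe_mk, if_true, mul_one, one_mul,
        MulAut.one_apply, _root_.mul_inv_rev, Units.val_mul,
        show ((-1 : ℤˣ) = 1) = False from by decide, show (-1 : ℤˣ) * -1 = 1 from by decide,
        if_false, h1, h2, ← mulVec_mulVec, ← vecMul_vecMul, mulVec_transpose, vecMul_transpose]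

instance vectorAction_continuous [TopologicalSpace F] [IsTopologicalRing F] :
    ContinuousConstSMul (GTilde F ι) (VVStar F ι) where
  continuous_const_smul x := by
    obtain ⟨g, s⟩ := x
    change Continuous fun p : VVStar F ι =>
      ((g : Matrix ι ι F) *ᵥ (if s = 1 then p.1 else p.2),
        (if s = 1 then p.2 else p.1) ᵥ* ((g⁻¹ : GL ι F) : Matrix ι ι F))
    by_cases h : s = 1
    · simp only [h, if_true]
      exact (continuous_const.matrix_mulVec continuous_fst).prodMk
        (continuous_snd.matrix_vecMul continuous_const)
    · simp only [h, if_false]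
      exact (continuous_const.matrix_mulVec continuous_snd).prodMk
        (continuous_fst.matrix_vecMul continuous_const)

/-- The stabilizer of `A` in `G ⋊ S₂`. -/
def CTilde (A : Matrix ι ι F) : Subgroup (GTilde F ι) := MulAction.stabilizer (GTilde F ι) A

/-- The stabilizer of `A` in `G`, as a subgroup of `G ⋊ S₂`. -/
def CGroup (A : Matrix ι ι F) : Subgroup (GTilde F ι) :=
  CTilde A ⊓ (SemidirectProduct.inl : GL ι F →* GTilde F ι).range

/-- `Q_A`: the pairs `(v, φ)` such that `v ⊗ φ` lies in `[A, gl(V)]`. -/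
def QSet (A : Matrix ι ι F) : Set (VVStar F ι) :=
  {p | ∃ B : Matrix ι ι F, vecMulVec p.1 p.2 = A * B - B * A}

end Group

section Nice

variable {F : Type*} [Field F] [CharZero F] [ValuativeRel F] [TopologicalSpace F]
  [IsNonarchimedeanLocalField F]

/-- A nilpotent `A ∈ sl(V)` is nice if every `C_A`-invariant distribution `η` on `V ⊕ V*` such
that `η` and its Fourier transform are supported in `Q_A` is invariant under the stabilizer of `A`
in `G ⋊ S₂`. -/
def IsNice {ψ : AddChar F Circle} (hψ : Continuous ψ) (hψ1 : ψ ≠ 1)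
    {ι : Type*} [Fintype ι] [DecidableEq ι] (A : Matrix ι ι F) : Prop :=
  A.trace = 0 ∧ IsNilpotent A ∧
    ∀ η : Distr (VVStar F ι), η.IsInvariant (CGroup A) → η.supp ⊆ QSet A →
      (η.fourier hψ hψ1).supp ⊆ QSet A → η.IsInvariant (CTilde A)

/-- The block diagonal operator `A₁ ⊕ A₂` on `F^(k + l) = F^k ⊕ F^l`. -/
def directSum {k l : ℕ} (A₁ : Matrix (Fin k) (Fin k) F) (A₂ : Matrix (Fin l) (Fin l) F) :
    Matrix (Fin (k + l)) (Fin (k + l)) F :=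
  Matrix.reindex finSumFinEquiv finSumFinEquiv (Matrix.fromBlocks A₁ 0 0 A₂)

end Nice

end GLMultOne

/-! Write `A`, `B` for the two nilpotents and split the space of pairs `(v, φ)` as a product of the
two smaller ones. For an invariant `η` on the product and a fixed Schwartz function `g` in the
second variable, consider the slice `η_g : f ↦ η (f ⊗ g)`. It satisfies the hypotheses of niceness
for `A`. Invariance under `C_A` holds because `a ⊕ 1` centralizes `A ⊕ B`. The support condition
holds because the first diagonal block of `[A ⊕ B, C]` is `[A, C₁₁]`, so `Q_{A ⊕ B}` projects into
`Q_A` (`comp_mem_QSet`). For the Fourier transform, write `g` as the transform of some `g'`. Up to a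
nonzero scalar the transform of `η_g` is then the slice of the transform of `η` at `g'`
(`exists_fourier_tensor`, `fourier_surjective`).

Hence every slice is invariant under the full stabilizer of `A` in `G ⋊ S₂`
(`IsNice.translate_tensor_left`), and by symmetry the same holds in the second variable for `B`.

A nilpotent matrix is conjugate to its transpose, so both stabilizers contain elements `gT` and
`hT`. Acting by `gT` on the first variable and by `hT` on the second fixes `η` on external products,
which span, and the composite action is that of `(g ⊕ h)T`. This element stabilizes `A ⊕ B` and lies
outside `G`. Since `C_{A ⊕ B}` has index two in the full stabilizer, one such element suffices. -/

namespace GLMultOne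

open MeasureTheory ValuativeRel Matrix Topology

set_option linter.unusedSectionVars false

/-! ### A nilpotent matrix is conjugate to its transpose. -/

section TransposeSimilarity

open Polynomial

variable {F : Type*} [Field F]

/-- In `F[X] / (X ^ k)` the class of `X ^ (k - 1)` is a multiple of every nonzero element. -/
theorem exists_X_pow_dvd_mul_sub {k : ℕ} {f : F[X]} (hf : ¬ X ^ k ∣ f) :
    ∃ r : F[X], X ^ k ∣ f * r - X ^ (k - 1) := by
  have hf0 : f ≠ 0 := by rintro rfl; simp at hf
  obtain ⟨j, g, hg, rfl⟩ : ∃ j g, ¬ X ∣ g ∧ f = X ^ j * g := by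
    have := (Polynomial.prime_X (R := F)).irreducible
    have hfin : FiniteMultiplicity (X : F[X]) f :=
      FiniteMultiplicity.of_not_isUnit this.not_isUnit hf0
    obtain ⟨g, h1, h2⟩ := hfin.exists_eq_pow_mul_and_not_dvd
    exact ⟨_, g, h2, h1⟩
  have hjk : j < k := by
    by_contra! h
    exact hf ((pow_dvd_pow X h).mul_right g)
  have hco : IsCoprime (X : F[X]) g :=
    (Polynomial.prime_X (R := F)).irreducible.coprime_iff_not_dvd.2 hg
  obtain ⟨a, b, hab⟩ := hco.pow_left (m := k)
  -- Here `f = X ^ j * g`, and `b` inverts `g` modulo `X ^ k`. The factor `X ^ (k - 1 - j)` lifts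
  -- the order of vanishing from `j` to `k - 1`.
  refine ⟨X ^ (k - 1 - j) * b, - a * X ^ (k - 1), ?_⟩
  have : (X : F[X]) ^ (k - 1) = X ^ j * X ^ (k - 1 - j) := by
    rw [← pow_add]; congr 1; omega
  rw [this]
  linear_combination (X ^ j * X ^ (k - 1 - j)) * hab

/-- `F[X] / (X ^ k)` carries a nondegenerate form for which `X` is self-adjoint. -/
theorem exists_form_quotient_X_pow (k : ℕ) :
    ∃ b : (F[X] ⧸ Ideal.span {(X : F[X]) ^ k}) →ₗ[F] (F[X] ⧸ Ideal.span {(X : F[X]) ^ k}) →ₗ[F] F,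
      (∀ x y, b ((X : F[X]) • x) y = b x ((X : F[X]) • y)) ∧ ∀ x ≠ 0, ∃ y, b x y ≠ 0 := by
  -- The form will be `(x, y) ↦ l (x * y)`. It is nondegenerate once `l` does not kill `X ^ (k -
  -- 1)`, a multiple of every nonzero class. For `k = 0` the quotient is zero and any `l` works.
  obtain ⟨l, hl⟩ : ∃ l : Module.Dual F (F[X] ⧸ Ideal.span {(X : F[X]) ^ k}),
      k ≠ 0 → l (Ideal.Quotient.mk _ (X ^ (k - 1))) ≠ 0 := by
    by_cases hk : k = 0
    · exact ⟨0, fun h => absurd hk h⟩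
    · have h0 : Ideal.Quotient.mk (Ideal.span {(X : F[X]) ^ k}) (X ^ (k - 1)) ≠ 0 := by
        rw [Ne, Ideal.Quotient.eq_zero_iff_mem, Ideal.mem_span_singleton,
          pow_dvd_pow_iff X_ne_zero (Polynomial.prime_X (R := F)).not_isUnit]
        omega
      have := (Module.forall_dual_apply_eq_zero_iff F _).not.2 h0
      push Not at this
      exact ⟨this.choose, fun _ => this.choose_spec⟩
  refine ⟨(LinearMap.mul F _).compr₂ l, fun x y => ?_, fun x hx => ?_⟩
  · rw [LinearMap.compr₂_apply, LinearMap.compr₂_apply, LinearMap.mul_apply',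
      LinearMap.mul_apply', smul_mul_assoc, mul_smul_comm]
  · obtain ⟨f, rfl⟩ := Ideal.Quotient.mk_surjective x
    rw [Ne, Ideal.Quotient.eq_zero_iff_mem, Ideal.mem_span_singleton] at hx
    obtain ⟨r, hr⟩ := exists_X_pow_dvd_mul_sub hx
    refine ⟨Ideal.Quotient.mk _ r, ?_⟩
    have : Ideal.Quotient.mk (Ideal.span {(X : F[X]) ^ k}) (f * r) =
        Ideal.Quotient.mk _ (X ^ (k - 1)) := by
      rwa [Ideal.Quotient.eq, Ideal.mem_span_singleton]
    simp only [LinearMap.compr₂_apply, LinearMap.mul_apply', ← map_mul, this]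
    exact hl (by rintro rfl; simp at hx)

/-- A nilpotent endomorphism is self-adjoint for some nondegenerate form. -/
theorem exists_form_of_isNilpotent {V : Type*} [AddCommGroup V] [Module F V] [Module.Finite F V]
    {a : V →ₗ[F] V} (ha : IsNilpotent a) :
    ∃ b : V →ₗ[F] V →ₗ[F] F, (∀ x y, b (a x) y = b x (a y)) ∧ ∀ x ≠ 0, ∃ y, b x y ≠ 0 := by
  classical
  obtain ⟨n, hn⟩ := ha
  -- Let `X` act on `V` through `a`. Nilpotence makes `V` an `X`-power torsion module, hence a sum
  -- of Jordan blocks `F[X] / (X ^ k i)`.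
  have htors : Module.IsTorsion' (Module.AEval' a) (Submonoid.powers (X : F[X])) := by
    intro x
    refine ⟨⟨X ^ n, n, rfl⟩, ?_⟩
    obtain ⟨v, rfl⟩ := (Module.AEval'.of a).surjective x
    change (X : F[X]) ^ n • Module.AEval'.of a v = 0
    rw [Module.AEval'.X_pow_smul_of, hn]
    simp
  obtain ⟨d, k, ⟨E⟩⟩ := Module.torsion_by_prime_power_decomposition
    (Polynomial.prime_X (R := F)).irreducible htors
  choose c hc1 hc2 using fun i => exists_form_quotient_X_pow (F := F) (k i)
  let N : Fin d → Type _ := fun i => F[X] ⧸ Ideal.span {(X : F[X]) ^ k i}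
  let E' : V →ₗ[F] (DirectSum (Fin d) N) :=
    (E.toLinearMap.restrictScalars F).comp (Module.AEval'.of a).toLinearMap
  have hE' (v : V) : E' (a v) = (X : F[X]) • E' v := by
    change E (Module.AEval'.of a (a v)) = (X : F[X]) • E (Module.AEval'.of a v)
    rw [← Module.AEval'.X_smul_of, map_smul]
  have hEs : Function.Surjective E' := E.surjective.comp (Module.AEval'.of a).surjective
  have hEi : Function.Injective E' := E.injective.comp (Module.AEval'.of a).injective
  -- Orthogonal sum of the block forms. A vector with nonzero `i`-th component is detected by a test
  -- vector concentrated in block `i`.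
  refine ⟨∑ i, (c i).compl₁₂ ((DirectSum.component F _ N i).comp E')
    ((DirectSum.component F _ N i).comp E'), fun x y => ?_, fun x hx => ?_⟩
  · simp only [LinearMap.sum_apply, LinearMap.compl₁₂_apply, LinearMap.comp_apply, hE']
    exact Finset.sum_congr rfl fun i _ => hc1 i _ _
  · have hx' : E' x ≠ 0 := fun h => hx (hEi (by rw [h, map_zero]))
    obtain ⟨i, hi⟩ : ∃ i, E' x i ≠ 0 := by
      by_contra! h
      exact hx' (DFinsupp.ext h)
    obtain ⟨z, hz⟩ := hc2 i _ hi
    obtain ⟨y, hy⟩ := hEs (DirectSum.of N i z)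
    refine ⟨y, ?_⟩
    simp only [LinearMap.sum_apply, LinearMap.compl₁₂_apply, LinearMap.comp_apply, hy]
    rw [Finset.sum_eq_single i]
    · change c i (E' x i) (DirectSum.of N i z i) ≠ 0
      rwa [DirectSum.of_eq_same]
    · intro j _ hj
      change c j (E' x j) (DirectSum.of N i z j) = 0
      rw [DirectSum.of_eq_of_ne _ _ _ hj, map_zero]
    · simp

/-- A nilpotent matrix is conjugate to its transpose. -/
theorem exists_conj_transpose {ι : Type*} [Fintype ι] [DecidableEq ι] {A : Matrix ι ι F}
    (hA : IsNilpotent A) :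
    ∃ g : GL ι F, (g : Matrix ι ι F) * Aᵀ * ((g⁻¹ : GL ι F) : Matrix ι ι F) = A := by
  obtain ⟨b, hb, hnd⟩ := exists_form_of_isNilpotent
    (hA.map (Matrix.toLinAlgEquiv' (R := F) (n := ι)))
  set P := LinearMap.toMatrix₂' F b with hP
  have hbP (x y : ι → F) : b x y = x ⬝ᵥ P *ᵥ y := by
    rw [← Matrix.toLinearMap₂'_apply', hP, Matrix.toLinearMap₂'_toMatrix']
  -- Self-adjointness of `A`, read on the Gram matrix `P`. Since `P` is invertible, conjugation by
  -- `P⁻¹` takes `Aᵀ` to `A`.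
  have hcomm : Aᵀ * P = P * A := by
    refine (Matrix.toLinearMap₂' F :
      Matrix ι ι F ≃ₗ[F] (ι → F) →ₗ[F] (ι → F) →ₗ[F] F).injective ?_
    refine LinearMap.ext₂ fun x y => ?_
    have := hb x y
    rw [hbP, hbP] at this
    simp only [Matrix.toLinAlgEquiv'_apply] at this
    rw [Matrix.toLinearMap₂'_apply', Matrix.toLinearMap₂'_apply', ← mulVec_mulVec,
      ← mulVec_mulVec, ← this, dotProduct_mulVec, vecMul_transpose]
  have hunit : IsUnit P := by
    rw [Matrix.isUnit_iff_isUnit_det, isUnit_iff_ne_zero]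
    intro h0
    obtain ⟨x, hx, hx0⟩ := Matrix.exists_vecMul_eq_zero_iff.2 h0
    obtain ⟨y, hy⟩ := hnd x hx
    rw [hbP, dotProduct_mulVec, hx0, zero_dotProduct] at hy
    exact hy rfl
  obtain ⟨g, hg⟩ := hunit
  refine ⟨g⁻¹, ?_⟩
  rw [inv_inv, Matrix.mul_assoc, hg, hcomm, ← hg, ← Matrix.mul_assoc]
  simp

/-- The stabilizer of a nilpotent matrix in `G ⋊ S₂` meets the nontrivial coset of `G`. -/
theorem exists_mem_CTilde_right {ι : Type*} [Fintype ι] [DecidableEq ι] {A : Matrix ι ι F}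
    (hA : IsNilpotent A) : ∃ x ∈ CTilde A, x.right = -1 := by
  obtain ⟨g, hg⟩ := exists_conj_transpose hA
  refine ⟨⟨g, -1⟩, ?_, rfl⟩
  rw [CTilde, MulAction.mem_stabilizer_iff]
  change (g : Matrix ι ι F) * (if (-1 : ℤˣ) = 1 then A else Aᵀ) * _ = A
  rw [if_neg (by decide)]
  exact hg

end TransposeSimilarity

/-! ### Indicators of lattice translates, and localization of distributions. -/

section Translates

variable {F : Type*} [Field F] [ValuativeRel F] [TopologicalSpace F]
  [IsNonarchimedeanLocalField F] {ι : Type*}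

/-- The indicator function of a translate of a lattice. -/
noncomputable def translateInd [Finite ι] (γ : ValueGroupWithZero F) (hγ : γ ≠ 0)
    (a : VVStar F ι) : Schwartz (VVStar F ι) :=
  ⟨fun x => (boxInd F ι γ hγ : VVStar F ι → ℂ) (x - a),
    (boxInd F ι γ hγ).2.1.comp_continuous (continuous_id.sub continuous_const),
    (boxInd F ι γ hγ).2.2.comp_homeomorph (Homeomorph.subRight a)⟩

open Classical in
theorem translateInd_apply [Finite ι] {γ : ValueGroupWithZero F} (hγ : γ ≠ 0)
    (a x : VVStar F ι) : (translateInd γ hγ a : VVStar F ι → ℂ) x =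
      if x - a ∈ box F ι γ then 1 else 0 := by
  simp [translateInd, boxInd, Set.indicator_apply]

variable (F ι) in
/-- The lattice `box F ι γ` as an additive subgroup. -/
def boxAddSubgroup (γ : ValueGroupWithZero F) : AddSubgroup (VVStar F ι) where
  carrier := box F ι γ
  add_mem' := box_add
  zero_mem' := box_zero_mem γ
  neg_mem' := box_neg

theorem tsupport_translateInd_subset [Finite ι] {γ : ValueGroupWithZero F} (hγ : γ ≠ 0)
    (a : VVStar F ι) :
    tsupport (translateInd γ hγ a : VVStar F ι → ℂ) ⊆ {x | x - a ∈ box F ι γ} := by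
  refine closure_minimal (fun x hx => ?_)
    ((box_closed hγ).preimage (continuous_id.sub continuous_const))
  by_contra h
  exact hx ((translateInd_apply hγ a x).trans (if_neg h))

/-- A Schwartz function invariant under a lattice is a combination of indicator functions of
translates of the lattice by points of its support. -/
theorem mem_span_translateInd [Finite ι] {γ : ValueGroupWithZero F} (hγ : γ ≠ 0)
    (f : Schwartz (VVStar F ι))
    (hf : ∀ h ∈ box F ι γ, ∀ x, (f : VVStar F ι → ℂ) (x + h) = (f : VVStar F ι → ℂ) x) :
    f ∈ Submodule.span ℂ
      (translateInd γ hγ '' {a | (f : VVStar F ι → ℂ) a ≠ 0}) := by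
  classical
  obtain ⟨t, -, ht⟩ := f.2.2.isCompact.elim_nhds_subcover
    (fun a => {x | x - a ∈ box F ι γ}) fun a _ =>
      ((box_open hγ).preimage (continuous_id.sub continuous_const)).mem_nhds
        (by simp [box_zero_mem])
  let L := boxAddSubgroup F ι γ
  have hmk (x a : VVStar F ι) : x - a ∈ box F ι γ ↔ (x : VVStar F ι ⧸ L) = a := by
    rw [eq_comm, QuotientAddGroup.eq, neg_add_eq_sub]; rfl
  have hfq (x a : VVStar F ι) (h : (x : VVStar F ι ⧸ L) = a) :
      (f : VVStar F ι → ℂ) x = (f : VVStar F ι → ℂ) a := by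
    simpa using hf _ ((hmk x a).2 h) a
  -- `f` is constant on cosets of the lattice and finitely many cosets cover its support. The sum
  -- runs over cosets rather than over `t`, so overlapping translates are not counted twice.
  have hsum : f = ∑ c ∈ t.image (QuotientAddGroup.mk (s := L)),
      (f : VVStar F ι → ℂ) c.out • translateInd γ hγ c.out := by
    ext x
    simp only [Submodule.coe_sum, Submodule.coe_smul, Finset.sum_apply, Pi.smul_apply, smul_eq_mul,
      translateInd_apply, hmk, QuotientAddGroup.out_eq', mul_ite, mul_one, mul_zero,
      Finset.sum_ite_eq]
    split_ifs with hx
    · exact hfq _ _ (QuotientAddGroup.out_eq' _).symm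
    · refine image_eq_zero_of_notMem_tsupport fun hx' => hx ?_
      obtain ⟨a, ha, hxa⟩ := Set.mem_iUnion₂.1 (ht hx')
      exact Finset.mem_image.2 ⟨a, ha, ((hmk x a).1 hxa).symm⟩
  have hmem := Submodule.sum_mem (t := t.image (QuotientAddGroup.mk (s := L)))
    (f := fun c => (f : VVStar F ι → ℂ) c.out • translateInd γ hγ c.out) (Submodule.span ℂ
      (translateInd γ hγ '' {a | (f : VVStar F ι → ℂ) a ≠ 0})) fun c _ => ?_
  · rwa [← hsum] at hmem
  by_cases hc : (f : VVStar F ι → ℂ) c.out = 0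
  · rw [hc, zero_smul]
    exact Submodule.zero_mem _
  · exact Submodule.smul_mem _ _ (Submodule.subset_span ⟨_, hc, rfl⟩)

/-- The indicator functions of translates of arbitrarily small lattices span. -/
theorem exists_mem_span_translateInd [Finite ι] (f : Schwartz (VVStar F ι)) :
    ∃ γ : ValueGroupWithZero F, γ ≠ 0 ∧ ∀ δ (hδ : δ ≠ 0), δ ≤ γ →
      f ∈ Submodule.span ℂ (translateInd δ hδ '' {a | (f : VVStar F ι → ℂ) a ≠ 0}) := by
  obtain ⟨γ, hγ, h⟩ := Schwartz.exists_box_invariant f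
  exact ⟨γ, hγ, fun δ hδ hle => mem_span_translateInd hδ f fun x hx => h x (box_mono hle hx)⟩

/-- A distribution supported in a closed set kills the functions supported away from it. -/
theorem Distr.vanishesOn_compl_of_supp_subset [Finite ι] {η : Distr (VVStar F ι)}
    {Q : Set (VVStar F ι)} (h : η.supp ⊆ Q) : η.VanishesOn Qᶜ := by
  intro f hf
  have hK : tsupport (f : VVStar F ι → ℂ) ⊆ ⋃₀ {U : Set (VVStar F ι) | IsOpen U ∧ η.VanishesOn U} :=
    fun x hx => by
      by_contra hx'
      exact hf hx (h hx')
  -- A Lebesgue number: by compactness one lattice works for all points of the support, each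
  -- translate lying in a single set where `η` vanishes. Cutting `f` into indicators of such
  -- translates then gives `η f = 0`.
  obtain ⟨γ, hγ, H⟩ : ∃ γ : ValueGroupWithZero F, γ ≠ 0 ∧ ∀ a ∈ tsupport (f : VVStar F ι → ℂ),
      ∃ U, η.VanishesOn U ∧ ∀ x, x - a ∈ box F ι γ → x ∈ U := by
    refine f.2.2.isCompact.induction_on (p := fun s => ∃ γ : ValueGroupWithZero F, γ ≠ 0 ∧
      ∀ a ∈ s, ∃ U, η.VanishesOn U ∧ ∀ x, x - a ∈ box F ι γ → x ∈ U)
      ⟨1, one_ne_zero, by simp⟩ (fun s t hst ⟨γ, h, ht⟩ => ⟨γ, h, fun x hx => ht x (hst hx)⟩) ?_ ?_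
    · rintro s t ⟨γ, hγ, hs⟩ ⟨δ, hδ, ht⟩
      refine ⟨min γ δ, min_ne_zero hγ hδ, fun a ha => ?_⟩
      rcases ha with ha | ha
      · obtain ⟨U, hU, hsub⟩ := hs a ha
        exact ⟨U, hU, fun x hx => hsub x (box_mono (min_le_left _ _) hx)⟩
      · obtain ⟨U, hU, hsub⟩ := ht a ha
        exact ⟨U, hU, fun x hx => hsub x (box_mono (min_le_right _ _) hx)⟩
    · intro a ha
      obtain ⟨U, ⟨hUo, hU⟩, haU⟩ := hK ha
      have h1 : {h : VVStar F ι | a + h ∈ U} ∈ 𝓝 0 :=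
        (hUo.preimage (by fun_prop : Continuous fun h : VVStar F ι => a + h)).mem_nhds (by simpa)
      obtain ⟨γ, hγ, hsub⟩ := box_basis h1
      refine ⟨(fun y => y - a) ⁻¹' box F ι γ, mem_nhdsWithin_of_mem_nhds
        (((box_open hγ).preimage (by fun_prop)).mem_nhds (by simp [box_zero_mem])), γ, hγ, ?_⟩
      refine fun y hy => ⟨U, hU, fun x hx => ?_⟩
      have := hsub (box_add hx hy)
      simpa using this
  obtain ⟨δ, hδ, hspan⟩ := exists_mem_span_translateInd f
  have hmin : min γ δ ≠ 0 := min_ne_zero hγ hδ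
  refine (Submodule.span_le (p := LinearMap.ker η)).2 ?_ (hspan (min γ δ) hmin (min_le_right _ _))
  rintro _ ⟨a, ha, rfl⟩
  obtain ⟨U, hU, hsub⟩ := H a (subset_tsupport _ ha)
  exact hU _ fun x hx =>
    hsub x (box_mono (min_le_left _ _) (tsupport_translateInd_subset hmin a hx))

end Translates

/-! ### Closedness of `Q_A`. -/

section QSetClosed

instance t2Space_of_isNonarchimedeanLocalField {F : Type*} [Field F] [ValuativeRel F]
    [TopologicalSpace F] [IsNonarchimedeanLocalField F] : T2Space F := by
  refine IsTopologicalAddGroup.t2Space_of_zero_sep fun x hx => ?_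
  have hv : valuation F x ≠ 0 := by simpa using hx
  exact ⟨{z | valuation F z < valuation F x},
    (IsValuativeTopology.mem_nhds_zero_iff _).2 ⟨Units.mk0 _ hv, subset_rfl⟩, by simp⟩

variable {F : Type*} [Field F] [TopologicalSpace F] [IsTopologicalRing F] [T1Space F]
  {ι : Type*} [Fintype ι]

/-- The image of `ad A` is a linear subspace, hence cut out by the functionals vanishing on it. Each
of these gives a polynomial equation in `(v, φ)`. Closedness lets the complement of `Q_A` serve as
an open set in the definition of the support. -/
theorem isClosed_QSet (A : Matrix ι ι F) : IsClosed (QSet A) := by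
  classical
  let ad : Matrix ι ι F →ₗ[F] Matrix ι ι F := LinearMap.mulLeft F A - LinearMap.mulRight F A
  have hQ : QSet A = ⋂ (φ : Matrix ι ι F →ₗ[F] F) (_ : LinearMap.range ad ≤ LinearMap.ker φ),
      {p : VVStar F ι | φ (vecMulVec p.1 p.2) = 0} := by
    ext p
    simp only [Set.mem_iInter, Set.mem_ofPred_eq]
    constructor
    · rintro ⟨B, hB⟩ φ hφ
      exact hφ ⟨B, by simp [ad, hB]⟩
    · intro h
      by_contra hp
      have hp' : vecMulVec p.1 p.2 ∉ LinearMap.range ad := by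
        rintro ⟨B, hB⟩
        exact hp ⟨B, by rw [← hB]; simp [ad]⟩
      obtain ⟨φ, h1, h2⟩ := Submodule.exists_dual_map_eq_bot_of_notMem hp' inferInstance
      refine h1 (h φ fun y hy => ?_)
      have : φ y ∈ (LinearMap.range ad).map φ := ⟨y, hy, rfl⟩
      rwa [h2] at this
  rw [hQ]
  refine isClosed_iInter fun φ => isClosed_iInter fun _ => ?_
  have : (fun p : VVStar F ι => φ (vecMulVec p.1 p.2)) =
      fun p => ∑ i, ∑ j, p.1 i * p.2 j * φ (Matrix.single i j 1) := by
    ext p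
    conv_lhs => rw [Matrix.matrix_eq_sum_single (vecMulVec p.1 p.2)]
    simp only [map_sum]
    refine Finset.sum_congr rfl fun i _ => Finset.sum_congr rfl fun j _ => ?_
    rw [← smul_eq_mul, ← map_smul, Matrix.smul_single, smul_eq_mul, mul_one, vecMulVec_apply]
  refine isClosed_singleton.preimage (f := fun p : VVStar F ι => φ (vecMulVec p.1 p.2)) ?_
  rw [this]
  fun_prop

end QSetClosed

/-! ### Splitting the coordinates into two groups. -/

section Restriction

variable {F : Type*} {ι κ m : Type*}

/-- Restriction of the coordinates along an injection of index types. -/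
def VVStar.comp (s : ι → m) (x : VVStar F m) : VVStar F ι := (x.1 ∘ s, x.2 ∘ s)

/-- Glueing the coordinates indexed by the two parts of `m ≃ ι ⊕ κ`. -/
def VVStar.glue (e : ι ⊕ κ ≃ m) (x : VVStar F ι) (y : VVStar F κ) : VVStar F m :=
  (Sum.elim x.1 y.1 ∘ e.symm, Sum.elim x.2 y.2 ∘ e.symm)

theorem VVStar.comp_inl_glue (e : ι ⊕ κ ≃ m) (x : VVStar F ι) (y : VVStar F κ) :
    (VVStar.glue e x y).comp (e ∘ Sum.inl) = x := by
  ext i <;> simp [VVStar.comp, VVStar.glue]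

theorem VVStar.comp_inr_glue (e : ι ⊕ κ ≃ m) (x : VVStar F ι) (y : VVStar F κ) :
    (VVStar.glue e x y).comp (e ∘ Sum.inr) = y := by
  ext i <;> simp [VVStar.comp, VVStar.glue]

theorem VVStar.glue_comp (e : ι ⊕ κ ≃ m) (x : VVStar F m) :
    VVStar.glue e (x.comp (e ∘ Sum.inl)) (x.comp (e ∘ Sum.inr)) = x := by
  ext i <;> obtain ⟨j | j, rfl⟩ := e.surjective i <;> simp [VVStar.comp, VVStar.glue]

theorem VVStar.continuous_comp [TopologicalSpace F] (s : ι → m) :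
    Continuous (VVStar.comp s : VVStar F m → VVStar F ι) := by
  unfold VVStar.comp Function.comp
  fun_prop

theorem VVStar.continuous_glue [TopologicalSpace F] (e : ι ⊕ κ ≃ m) :
    Continuous fun p : VVStar F ι × VVStar F κ => VVStar.glue e p.1 p.2 := by
  refine Continuous.prodMk (continuous_pi fun i => ?_) (continuous_pi fun i => ?_) <;>
    obtain ⟨j | j, rfl⟩ := e.surjective i <;> simp <;> fun_prop

theorem form_zero_left [Field F] [Fintype ι] (x : VVStar F ι) : form 0 x = 0 := by simp [form]

/-- The two summands are orthogonal for `B`, so the Fourier kernel factors as a product. -/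
theorem form_glue [Field F] [Fintype ι] [Fintype κ] [Fintype m] (e : ι ⊕ κ ≃ m)
    (x y : VVStar F m) : form x y =
      form (x.comp (e ∘ Sum.inl)) (y.comp (e ∘ Sum.inl)) +
        form (x.comp (e ∘ Sum.inr)) (y.comp (e ∘ Sum.inr)) := by
  simp only [form, dotProduct, ← Equiv.sum_comp e, Fintype.sum_sum_type, VVStar.comp,
    Function.comp_apply]
  ring

theorem mem_box_iff [Field F] [ValuativeRel F] (e : ι ⊕ κ ≃ m)
    {γ : ValueGroupWithZero F} {x : VVStar F m} : x ∈ box F m γ ↔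
      x.comp (e ∘ Sum.inl) ∈ box F ι γ ∧ x.comp (e ∘ Sum.inr) ∈ box F κ γ := by
  simp only [box, Set.mem_ofPred_eq, ← e.forall_congr_right, Sum.forall, VVStar.comp,
    Function.comp_apply]
  tauto

end Restriction

/-! ### External products of Schwartz functions. -/

section Tensor

variable {F : Type*} [Field F] [TopologicalSpace F] [IsTopologicalRing F] {ι κ m : Type*}

/-- The external product `f ⊗ g` of Schwartz functions. -/
def Schwartz.tensor (e : ι ⊕ κ ≃ m) :
    Schwartz (VVStar F ι) →ₗ[ℂ] Schwartz (VVStar F κ) →ₗ[ℂ] Schwartz (VVStar F m) :=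
  LinearMap.mk₂ ℂ (fun f g => ⟨fun x => (f : VVStar F ι → ℂ) (x.comp (e ∘ Sum.inl)) *
      (g : VVStar F κ → ℂ) (x.comp (e ∘ Sum.inr)),
    (f.2.1.comp_continuous (VVStar.continuous_comp _)).mul
      (g.2.1.comp_continuous (VVStar.continuous_comp _)), by
    refine HasCompactSupport.intro ((f.2.2.isCompact.prod g.2.2.isCompact).image
      (VVStar.continuous_glue e)) fun x hx => ?_
    by_contra hne
    exact hx ⟨(x.comp (e ∘ Sum.inl), x.comp (e ∘ Sum.inr)),
      ⟨subset_tsupport _ (left_ne_zero_of_mul hne), subset_tsupport _ (right_ne_zero_of_mul hne)⟩,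
      VVStar.glue_comp e x⟩⟩)
    (fun _ _ _ => Subtype.ext (funext fun _ => add_mul _ _ _))
    (fun _ _ _ => Subtype.ext (funext fun _ => mul_assoc _ _ _))
    (fun _ _ _ => Subtype.ext (funext fun _ => mul_add _ _ _))
    (fun _ _ _ => Subtype.ext (funext fun _ => mul_left_comm _ _ _))

theorem Schwartz.tensor_apply (e : ι ⊕ κ ≃ m) (f : Schwartz (VVStar F ι))
    (g : Schwartz (VVStar F κ)) (x : VVStar F m) :
    (Schwartz.tensor e f g : VVStar F m → ℂ) x = (f : VVStar F ι → ℂ) (x.comp (e ∘ Sum.inl)) *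
      (g : VVStar F κ → ℂ) (x.comp (e ∘ Sum.inr)) := rfl

/-- Together with `blockSum_sumComm`, this transfers results on the first factor to the second. -/
theorem Schwartz.tensor_sumComm (e : ι ⊕ κ ≃ m) (f : Schwartz (VVStar F ι))
    (g : Schwartz (VVStar F κ)) :
    Schwartz.tensor ((Equiv.sumComm κ ι).trans e) g f = Schwartz.tensor e f g :=
  Subtype.ext (funext fun _ => mul_comm _ _)

theorem Schwartz.tsupport_tensor_subset (e : ι ⊕ κ ≃ m) (f : Schwartz (VVStar F ι))
    (g : Schwartz (VVStar F κ)) : tsupport (Schwartz.tensor e f g : VVStar F m → ℂ) ⊆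
      VVStar.comp (e ∘ Sum.inl) ⁻¹' tsupport (f : VVStar F ι → ℂ) :=
  closure_minimal (fun _ hx => subset_tsupport _ (left_ne_zero_of_mul hx))
    ((isClosed_tsupport _).preimage (VVStar.continuous_comp _))

variable [ValuativeRel F] [IsNonarchimedeanLocalField F] [Finite ι] [Finite κ] [Finite m]

/-- A lattice `box` is the product of the two boxes of the same radius. Since indicators of its
translates span, so do external products. -/
theorem tensor_translateInd (e : ι ⊕ κ ≃ m) {γ : ValueGroupWithZero F} (hγ : γ ≠ 0)
    (a : VVStar F ι) (b : VVStar F κ) :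
    Schwartz.tensor e (translateInd γ hγ a) (translateInd γ hγ b) =
      translateInd γ hγ (VVStar.glue e a b) := by
  classical
  ext x
  have h1 : (x - VVStar.glue e a b).comp (e ∘ Sum.inl) = x.comp (e ∘ Sum.inl) - a := by
    conv_rhs => rw [← VVStar.comp_inl_glue e a b]
    rfl
  have h2 : (x - VVStar.glue e a b).comp (e ∘ Sum.inr) = x.comp (e ∘ Sum.inr) - b := by
    conv_rhs => rw [← VVStar.comp_inr_glue e a b]
    rfl
  rw [Schwartz.tensor_apply, translateInd_apply, translateInd_apply, translateInd_apply,
    mem_box_iff e, h1, h2, ite_zero_mul_ite_zero, mul_one]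
  congr

/-- Distributions that agree on external products are equal. -/
theorem Distr.ext_tensor (e : ι ⊕ κ ≃ m) {ξ η : Distr (VVStar F m)}
    (h : ∀ f g, ξ (Schwartz.tensor e f g) = η (Schwartz.tensor e f g)) : ξ = η := by
  ext f
  obtain ⟨γ, hγ, hspan⟩ := exists_mem_span_translateInd f
  refine LinearMap.eqOn_span ?_ (hspan γ hγ le_rfl)
  rintro _ ⟨a, -, rfl⟩
  rw [← VVStar.glue_comp e a, ← tensor_translateInd]
  exact h _ _

end Tensor

/-! ### The Fourier transform and external products. -/

section FourierTensor

variable {F : Type*} [Field F] [CharZero F] [ValuativeRel F] [TopologicalSpace F]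
  [IsNonarchimedeanLocalField F] {ι κ m : Type*} [Fintype ι] [Fintype κ] [Fintype m]
  {ψ : AddChar F Circle} (hψ : Continuous ψ) (hψ1 : ψ ≠ 1)

open Classical in
/-- The Fourier transform of the indicator function of a translate of a lattice. -/
theorem exists_fourier_translateInd {γ : ValueGroupWithZero F} (hγ : γ ≠ 0) :
    ∃ c : ℂ, c ≠ 0 ∧ ∀ a y : VVStar F ι,
      (Schwartz.fourier hψ hψ1 (translateInd γ hγ a) : VVStar F ι → ℂ) y =
        c * ψ (form a y) * if ∀ h ∈ box F ι γ, ψ (form h y) = 1 then 1 else 0 := by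
  let : MeasurableSpace (VVStar F ι) := borel _
  have : BorelSpace (VVStar F ι) := ⟨rfl⟩
  set μ : Measure (VVStar F ι) := selfDualMeasure ι hψ hψ1
  have : μ.IsAddHaarMeasure := (exists_isSelfDual (ι := ι) hψ hψ1).choose_spec.haar
  have hpos : 0 < μ.real (box F ι γ) :=
    ENNReal.toReal_pos ((box_open hγ).measure_pos μ ⟨0, box_zero_mem _⟩).ne'
      (box_compact _).measure_lt_top.ne
  -- The constant is the volume of the lattice, the same for all translates; moving the centre to
  -- `a` only contributes a phase. A character nontrivial on the lattice integrates to zero over it.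
  refine ⟨(μ.real (box F ι γ) : ℂ), by exact_mod_cast hpos.ne', fun a y => ?_⟩
  have h1 : (Schwartz.fourier hψ hψ1 (translateInd γ hγ a) : VVStar F ι → ℂ) y =
      (ψ (form a y) : ℂ) * fourierFun ψ μ (boxInd F ι γ hγ) y := by
    change fourierFun ψ μ (translateInd γ hγ a) y = _
    rw [fourierFun, fourierFun, ← integral_add_right_eq_self _ a, ← integral_const_mul]
    congr 1; ext x
    rw [char_form_add_left]
    simp only [translateInd, add_sub_cancel_right]
    ring
  rw [h1]
  split_ifs with hy
  · have : fourierFun ψ μ (boxInd F ι γ hγ) y = (μ.real (box F ι γ) : ℂ) := by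
      rw [fourierFun, show (fun x => (ψ (form x y) : ℂ) *
        (boxInd F ι γ hγ : VVStar F ι → ℂ) x) =
          (box F ι γ).indicator (fun _ => (1 : ℂ)) from ?_]
      · rw [integral_indicator (box_open hγ).measurableSet]; simp
      · ext x
        by_cases hx : x ∈ box F ι γ
        · simp [boxInd, hx, hy x hx]
        · simp [boxInd, hx]
    rw [this]
    ring
  · push Not at hy
    obtain ⟨h, hh, hne⟩ := hy
    rw [fourierFun_eq_zero (boxInd_add hγ hh) hne]
    simp

theorem annihilator_box_iff (e : ι ⊕ κ ≃ m) (γ : ValueGroupWithZero F) (y : VVStar F m) :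
    (∀ h ∈ box F m γ, ψ (form h y) = 1) ↔
      (∀ h ∈ box F ι γ, ψ (form h (y.comp (e ∘ Sum.inl))) = 1) ∧
        ∀ h ∈ box F κ γ, ψ (form h (y.comp (e ∘ Sum.inr))) = 1 := by
  refine ⟨fun H => ⟨fun h hh => ?_, fun h hh => ?_⟩, fun H h hh => ?_⟩
  · have := H (VVStar.glue e h 0) ((mem_box_iff e).2
      ⟨by rwa [VVStar.comp_inl_glue], by rw [VVStar.comp_inr_glue]; exact box_zero_mem γ⟩)
    rwa [form_glue e, VVStar.comp_inl_glue, VVStar.comp_inr_glue, form_zero_left, add_zero] at this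
  · have := H (VVStar.glue e 0 h) ((mem_box_iff e).2
      ⟨by rw [VVStar.comp_inl_glue]; exact box_zero_mem γ, by rwa [VVStar.comp_inr_glue]⟩)
    rwa [form_glue e, VVStar.comp_inl_glue, VVStar.comp_inr_glue, form_zero_left, zero_add] at this
  · rw [form_glue e, AddChar.map_add_eq_mul, H.1 _ ((mem_box_iff e).1 hh).1,
      H.2 _ ((mem_box_iff e).1 hh).2, one_mul]

/-- The Fourier transform of an external product is, up to a nonzero constant, the external
product of the Fourier transforms. -/
theorem exists_fourier_tensor (e : ι ⊕ κ ≃ m) (f : Schwartz (VVStar F ι))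
    (g : Schwartz (VVStar F κ)) :
    ∃ c : ℂ, c ≠ 0 ∧ Schwartz.fourier hψ hψ1 (Schwartz.tensor e f g) =
      c • Schwartz.tensor e (Schwartz.fourier hψ hψ1 f) (Schwartz.fourier hψ hψ1 g) := by
  obtain ⟨γ, hγ, hf⟩ := exists_mem_span_translateInd f
  obtain ⟨δ, hδ, hg⟩ := exists_mem_span_translateInd g
  have hmin : min γ δ ≠ 0 := min_ne_zero hγ hδ
  replace hf := hf _ hmin (min_le_left _ _)
  replace hg := hg _ hmin (min_le_right _ _)
  obtain ⟨c₁, hc₁, h₁⟩ := exists_fourier_translateInd (ι := ι) hψ hψ1 hmin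
  obtain ⟨c₂, hc₂, h₂⟩ := exists_fourier_translateInd (ι := κ) hψ hψ1 hmin
  obtain ⟨c, hc, h⟩ := exists_fourier_translateInd (ι := m) hψ hψ1 hmin
  -- This compares the normalizations of the three measures on a common lattice. Only its
  -- nonvanishing is needed, so the measures need not be shown to be compatible.
  refine ⟨c / (c₁ * c₂), div_ne_zero hc (mul_ne_zero hc₁ hc₂), ?_⟩
  have key (a : VVStar F ι) (b : VVStar F κ) : Schwartz.fourier hψ hψ1
      (Schwartz.tensor e (translateInd _ hmin a) (translateInd _ hmin b)) =
      (c / (c₁ * c₂)) • Schwartz.tensor e (Schwartz.fourier hψ hψ1 (translateInd _ hmin a))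
        (Schwartz.fourier hψ hψ1 (translateInd _ hmin b)) := by
    classical
    ext y
    rw [tensor_translateInd, h, Submodule.coe_smul, Pi.smul_apply, Schwartz.tensor_apply, h₁, h₂,
      form_glue e, VVStar.comp_inl_glue, VVStar.comp_inr_glue, AddChar.map_add_eq_mul,
      Circle.coe_mul, smul_eq_mul]
    simp only [annihilator_box_iff e (min γ δ) y, ite_and]
    split_ifs
    · field_simp
    all_goals simp
  -- The scalar does not depend on `a` or `b`, so the identity extends by linearity, first in `g`
  -- and then in `f`.
  have key₂ (a : VVStar F ι) : Schwartz.fourier hψ hψ1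
      (Schwartz.tensor e (translateInd _ hmin a) g) =
      (c / (c₁ * c₂)) • Schwartz.tensor e (Schwartz.fourier hψ hψ1 (translateInd _ hmin a))
        (Schwartz.fourier hψ hψ1 g) := by
    refine LinearMap.eqOn_span (f := Schwartz.fourier hψ hψ1 ∘ₗ
        Schwartz.tensor e (translateInd _ hmin a))
      (g := (c / (c₁ * c₂)) • (Schwartz.tensor e (Schwartz.fourier hψ hψ1
        (translateInd _ hmin a)) ∘ₗ Schwartz.fourier hψ hψ1)) ?_ hg
    rintro _ ⟨b, -, rfl⟩
    exact key a b
  refine LinearMap.eqOn_span (f := Schwartz.fourier hψ hψ1 ∘ₗ (Schwartz.tensor e).flip g)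
    (g := (c / (c₁ * c₂)) • ((Schwartz.tensor e).flip (Schwartz.fourier hψ hψ1 g) ∘ₗ
      Schwartz.fourier hψ hψ1)) ?_ hf
  rintro _ ⟨a, -, rfl⟩
  exact key₂ a

/-- The square of the transform is the reflection `z ↦ -z`, so its fourth power is the identity and
its cube is a right inverse. -/
theorem fourier_surjective : Function.Surjective (Schwartz.fourier (ι := ι) hψ hψ1) := by
  intro f
  have H (f : Schwartz (VVStar F ι)) (z : VVStar F ι) :
      (Schwartz.fourier hψ hψ1 (Schwartz.fourier hψ hψ1 f) : VVStar F ι → ℂ) z =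
        (f : VVStar F ι → ℂ) (-z) :=
    (exists_isSelfDual (ι := ι) hψ hψ1).choose_spec.inversion f z
  refine ⟨Schwartz.fourier hψ hψ1 (Schwartz.fourier hψ hψ1 (Schwartz.fourier hψ hψ1 f)), ?_⟩
  ext z
  rw [H, H, neg_neg]

end FourierTensor

/-! ### Block diagonal operators and group elements. -/

section Block

variable {F : Type*} [Field F] {ι κ m : Type*} [Fintype ι] [Fintype κ] [Fintype m]
  [DecidableEq ι] [DecidableEq κ] [DecidableEq m]

/-- The block diagonal matrix with two given blocks, indexed by `m ≃ ι ⊕ κ`. -/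
def blockSum (e : ι ⊕ κ ≃ m) (A : Matrix ι ι F) (B : Matrix κ κ F) : Matrix m m F :=
  Matrix.reindex e e (Matrix.fromBlocks A 0 0 B)

theorem blockSum_mul (e : ι ⊕ κ ≃ m) (A A' : Matrix ι ι F) (B B' : Matrix κ κ F) :
    blockSum e A B * blockSum e A' B' = blockSum e (A * A') (B * B') := by
  simp only [blockSum, reindex_apply, submatrix_mul_equiv, fromBlocks_multiply]
  simp

theorem blockSum_one (e : ι ⊕ κ ≃ m) :
    blockSum e (1 : Matrix ι ι F) (1 : Matrix κ κ F) = 1 := by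
  simp [blockSum]

theorem blockSum_transpose (e : ι ⊕ κ ≃ m) (A : Matrix ι ι F) (B : Matrix κ κ F) :
    (blockSum e A B)ᵀ = blockSum e Aᵀ Bᵀ := by
  simp [blockSum, fromBlocks_transpose]

theorem blockSum_sumComm (e : ι ⊕ κ ≃ m) (A : Matrix ι ι F) (B : Matrix κ κ F) :
    blockSum ((Equiv.sumComm κ ι).trans e) B A = blockSum e A B := by
  ext i j
  obtain ⟨i | i, rfl⟩ := e.surjective i <;> obtain ⟨j | j, rfl⟩ := e.surjective j <;>
    simp [blockSum]

theorem blockSum_pow (e : ι ⊕ κ ≃ m) (A : Matrix ι ι F) (B : Matrix κ κ F) (n : ℕ) :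
    blockSum e A B ^ n = blockSum e (A ^ n) (B ^ n) := by
  induction n with
  | zero => simp [blockSum_one]
  | succ n ih => rw [pow_succ, ih, blockSum_mul, pow_succ, pow_succ]

theorem isNilpotent_blockSum (e : ι ⊕ κ ≃ m) {A : Matrix ι ι F} {B : Matrix κ κ F}
    (hA : IsNilpotent A) (hB : IsNilpotent B) : IsNilpotent (blockSum e A B) := by
  obtain ⟨p, hp⟩ := hA
  obtain ⟨q, hq⟩ := hB
  refine ⟨p + q, ?_⟩
  rw [blockSum_pow, pow_add, hp, zero_mul, pow_add, hq, mul_zero]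
  simp [blockSum]

theorem trace_blockSum (e : ι ⊕ κ ≃ m) (A : Matrix ι ι F) (B : Matrix κ κ F) :
    (blockSum e A B).trace = A.trace + B.trace := by
  simp [blockSum, trace, ← Equiv.sum_comp e]

theorem blockSum_mulVec (e : ι ⊕ κ ≃ m) (A : Matrix ι ι F) (B : Matrix κ κ F) (v : m → F) :
    blockSum e A B *ᵥ v =
      Sum.elim (A *ᵥ (v ∘ e ∘ Sum.inl)) (B *ᵥ (v ∘ e ∘ Sum.inr)) ∘ e.symm := by
  rw [blockSum, reindex_apply, submatrix_mulVec_equiv, fromBlocks_mulVec]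
  simp [Function.comp_assoc]

theorem vecMul_blockSum (e : ι ⊕ κ ≃ m) (A : Matrix ι ι F) (B : Matrix κ κ F) (v : m → F) :
    v ᵥ* blockSum e A B =
      Sum.elim ((v ∘ e ∘ Sum.inl) ᵥ* A) ((v ∘ e ∘ Sum.inr) ᵥ* B) ∘ e.symm := by
  rw [← mulVec_transpose, blockSum_transpose, blockSum_mulVec, mulVec_transpose, mulVec_transpose]

/-- The off-diagonal blocks of `A ⊕ B` vanish, so the first diagonal block of `[A ⊕ B, C]` involves
only the corresponding block of `C`, which is the witness. -/
theorem comp_mem_QSet (e : ι ⊕ κ ≃ m) {A : Matrix ι ι F} {B : Matrix κ κ F} {x : VVStar F m}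
    (hx : x ∈ QSet (blockSum e A B)) : x.comp (e ∘ Sum.inl) ∈ QSet A := by
  obtain ⟨C, hC⟩ := hx
  refine ⟨C.submatrix (e ∘ Sum.inl) (e ∘ Sum.inl), ?_⟩
  ext i j
  have := congr_fun₂ hC (e (Sum.inl i)) (e (Sum.inl j))
  simpa [vecMulVec_apply, VVStar.comp, mul_apply, blockSum, ← Equiv.sum_comp e] using this

/-- The block diagonal element of `GL`. -/
def blockGL (e : ι ⊕ κ ≃ m) (g : GL ι F) (h : GL κ F) : GL m F :=
  ⟨blockSum e g h, blockSum e ((g⁻¹ : GL ι F) : Matrix ι ι F) ((h⁻¹ : GL κ F) : Matrix κ κ F),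
    by rw [blockSum_mul]; simp [blockSum_one], by rw [blockSum_mul]; simp [blockSum_one]⟩

/-- The element of `G ⋊ S₂` with block diagonal first component. -/
def blockGTilde (e : ι ⊕ κ ≃ m) (g : GL ι F) (h : GL κ F) (s : ℤˣ) : GTilde F m :=
  ⟨blockGL e g h, s⟩

theorem smul_eq (g : GL ι F) (s : ℤˣ) (x : VVStar F ι) :
    ((⟨g, s⟩ : GTilde F ι) • x) = ((g : Matrix ι ι F) *ᵥ (if s = 1 then x.1 else x.2),
      (if s = 1 then x.2 else x.1) ᵥ* ((g⁻¹ : GL ι F) : Matrix ι ι F)) := rfl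

theorem smul_matrix_eq (g : GL ι F) (s : ℤˣ) (A : Matrix ι ι F) :
    ((⟨g, s⟩ : GTilde F ι) • A) = (g : Matrix ι ι F) * (if s = 1 then A else Aᵀ) *
      ((g⁻¹ : GL ι F) : Matrix ι ι F) := rfl

theorem blockGTilde_smul (e : ι ⊕ κ ≃ m) (g : GL ι F) (h : GL κ F) (s : ℤˣ) (x : VVStar F m) :
    blockGTilde e g h s • x = VVStar.glue e ((⟨g, s⟩ : GTilde F ι) • x.comp (e ∘ Sum.inl))
      ((⟨h, s⟩ : GTilde F κ) • x.comp (e ∘ Sum.inr)) := by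
  have h1 : ((blockGL e g h : GL m F) : Matrix m m F) = blockSum e g h := rfl
  have h2 : (((blockGL e g h)⁻¹ : GL m F) : Matrix m m F) =
    blockSum e ((g⁻¹ : GL ι F) : Matrix ι ι F) ((h⁻¹ : GL κ F) : Matrix κ κ F) := rfl
  rw [blockGTilde, smul_eq, smul_eq, smul_eq, h1, h2, blockSum_mulVec, vecMul_blockSum,
    VVStar.glue]
  split_ifs <;> rfl

/-- Transposition preserves block diagonal form. The sign `s` must be common to both factors, since
`T` transposes both blocks at once. -/
theorem blockGTilde_mem_CTilde (e : ι ⊕ κ ≃ m) {A : Matrix ι ι F} {B : Matrix κ κ F}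
    {g : GL ι F} {h : GL κ F} {s : ℤˣ} (hg : (⟨g, s⟩ : GTilde F ι) ∈ CTilde A)
    (hh : (⟨h, s⟩ : GTilde F κ) ∈ CTilde B) :
    blockGTilde e g h s ∈ CTilde (blockSum e A B) := by
  rw [CTilde, MulAction.mem_stabilizer_iff, smul_matrix_eq] at hg hh
  have h1 : ((blockGL e g h : GL m F) : Matrix m m F) = blockSum e g h := rfl
  have h2 : (((blockGL e g h)⁻¹ : GL m F) : Matrix m m F) =
    blockSum e ((g⁻¹ : GL ι F) : Matrix ι ι F) ((h⁻¹ : GL κ F) : Matrix κ κ F) := rfl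
  rw [CTilde, MulAction.mem_stabilizer_iff, blockGTilde, smul_matrix_eq, h1, h2]
  have : (if s = 1 then blockSum e A B else (blockSum e A B)ᵀ) =
      blockSum e (if s = 1 then A else Aᵀ) (if s = 1 then B else Bᵀ) := by
    split_ifs
    · rfl
    · exact blockSum_transpose e A B
  rw [this, blockSum_mul, blockSum_mul, hg, hh]

theorem mem_CGroup_iff {A : Matrix ι ι F} {x : GTilde F ι} :
    x ∈ CGroup A ↔ x ∈ CTilde A ∧ x.right = 1 := by
  rw [CGroup, Subgroup.mem_inf, SemidirectProduct.range_inl_eq_ker_rightHom, MonoidHom.mem_ker]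
  rfl

variable [TopologicalSpace F] [IsTopologicalRing F]

theorem translate_tensor (e : ι ⊕ κ ≃ m) (g : GL ι F) (h : GL κ F) (s : ℤˣ)
    (f₁ : Schwartz (VVStar F ι)) (f₂ : Schwartz (VVStar F κ)) :
    Schwartz.translate (blockGTilde e g h s) (Schwartz.tensor e f₁ f₂) =
      Schwartz.tensor e (Schwartz.translate (⟨g, s⟩ : GTilde F ι) f₁)
        (Schwartz.translate (⟨h, s⟩ : GTilde F κ) f₂) := by
  ext x
  change (Schwartz.tensor e f₁ f₂ : VVStar F m → ℂ) (blockGTilde e g h s • x) = _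
  rw [Schwartz.tensor_apply, blockGTilde_smul, VVStar.comp_inl_glue, VVStar.comp_inr_glue]
  rfl

/-- Precomposition reverses the order of the factors. -/
theorem translate_mul (x y : GTilde F ι) (f : Schwartz (VVStar F ι)) :
    Schwartz.translate (x * y) f = Schwartz.translate y (Schwartz.translate x f) :=
  Subtype.ext (funext fun w => congrArg (f : VVStar F ι → ℂ) (mul_smul x y w))

theorem translate_one (f : Schwartz (VVStar F ι)) :
    Schwartz.translate (1 : GTilde F ι) f = f :=
  Subtype.ext (funext fun w => congrArg (f : VVStar F ι → ℂ) (one_smul _ w))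

/-- A `C_A`-invariant distribution fixed by one element of `C̃_A` outside `G` is
`C̃_A`-invariant. -/
theorem Distr.isInvariant_CTilde {A : Matrix ι ι F} {η : Distr (VVStar F ι)}
    (hη : η.IsInvariant (CGroup A)) {z : GTilde F ι} (hz : z ∈ CTilde A) (hzr : z.right = -1)
    (hinv : ∀ f, η (Schwartz.translate z f) = η f) : η.IsInvariant (CTilde A) := by
  intro x hx f
  rcases Int.units_eq_one_or x.right with h | h
  · exact hη x (mem_CGroup_iff.2 ⟨hx, h⟩) f
  -- Both `x` and `z` lie in the nontrivial coset, so `x = (x * z⁻¹) * z` with `x * z⁻¹` in `C_A`.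
  · have hr : (x * z⁻¹).right = 1 := by
      rw [SemidirectProduct.mul_right, SemidirectProduct.inv_right, h, hzr]; rfl
    have := hη _ (mem_CGroup_iff.2 ⟨mul_mem hx (inv_mem hz), hr⟩) f
    rw [← this, ← hinv (Schwartz.translate (x * z⁻¹) f), ← translate_mul, inv_mul_cancel_right]

end Block

/-! ### Slices of a distribution and the direct sum of nice elements. -/

section DirectSum

variable {F : Type*} [Field F] [CharZero F] [ValuativeRel F] [TopologicalSpace F]
  [IsNonarchimedeanLocalField F] {ι κ m : Type*} [Fintype ι] [Fintype κ] [Fintype m]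
  [DecidableEq ι] [DecidableEq κ] [DecidableEq m]
  {ψ : AddChar F Circle} {hψ : Continuous ψ} {hψ1 : ψ ≠ 1}

/-- Contraction of a distribution with a Schwartz function in the second group of variables. -/
def Distr.contract (e : ι ⊕ κ ≃ m) (η : Distr (VVStar F m)) (g : Schwartz (VVStar F κ)) :
    Distr (VVStar F ι) :=
  η ∘ₗ (Schwartz.tensor e).flip g

/-- If `f` is supported off `Q_A`, then `f ⊗ g` is supported off the preimage of `Q_A`, which
contains `Q_{A ⊕ B}`. -/
theorem Distr.supp_contract_subset (e : ι ⊕ κ ≃ m) {A : Matrix ι ι F} {B : Matrix κ κ F}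
    {η : Distr (VVStar F m)} (h : η.supp ⊆ QSet (blockSum e A B)) (g : Schwartz (VVStar F κ)) :
    (η.contract e g).supp ⊆ QSet A := by
  intro x hx
  by_contra hxQ
  refine hx ⟨(QSet A)ᶜ, ⟨(isClosed_QSet A).isOpen_compl, fun f hf => ?_⟩, hxQ⟩
  exact η.vanishesOn_compl_of_supp_subset h _ fun y hy hyQ =>
    hf (Schwartz.tsupport_tensor_subset e f g hy) (comp_mem_QSet e hyQ)

/-- Once `g` is written as a Fourier transform, the transform of the slice is a nonzero multiple of
a slice of the transform of `η`, and the previous support argument applies. -/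
theorem Distr.supp_fourier_contract_subset (e : ι ⊕ κ ≃ m) {A : Matrix ι ι F}
    {B : Matrix κ κ F} {η : Distr (VVStar F m)}
    (h : (η.fourier hψ hψ1).supp ⊆ QSet (blockSum e A B)) (g : Schwartz (VVStar F κ)) :
    ((η.contract e g).fourier hψ hψ1).supp ⊆ QSet A := by
  intro x hx
  by_contra hxQ
  refine hx ⟨(QSet A)ᶜ, ⟨(isClosed_QSet A).isOpen_compl, fun f hf => ?_⟩, hxQ⟩
  obtain ⟨g, rfl⟩ := fourier_surjective hψ hψ1 g
  obtain ⟨c, hc, hF⟩ := exists_fourier_tensor hψ hψ1 e f g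
  have h0 : η (Schwartz.fourier hψ hψ1 (Schwartz.tensor e f g)) = 0 :=
    (η.fourier hψ hψ1).vanishesOn_compl_of_supp_subset h _ fun y hy hyQ =>
      hf (Schwartz.tsupport_tensor_subset e f g hy) (comp_mem_QSet e hyQ)
  rw [hF, map_smul, smul_eq_zero] at h0
  exact h0.resolve_left hc

/-- A distribution satisfying the hypotheses of niceness for `A ⊕ B` is invariant under
`C̃_A` in the first group of variables if `A` is nice. -/
theorem IsNice.translate_tensor_left (e : ι ⊕ κ ≃ m) {A : Matrix ι ι F} {B : Matrix κ κ F}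
    (hA : IsNice hψ hψ1 A) {η : Distr (VVStar F m)}
    (hη : η.IsInvariant (CGroup (blockSum e A B))) (hs : η.supp ⊆ QSet (blockSum e A B))
    (hsF : (η.fourier hψ hψ1).supp ⊆ QSet (blockSum e A B)) {x : GTilde F ι} (hx : x ∈ CTilde A)
    (f : Schwartz (VVStar F ι)) (g : Schwartz (VVStar F κ)) :
    η (Schwartz.tensor e (Schwartz.translate x f) g) = η (Schwartz.tensor e f g) := by
  refine hA.2.2 (η.contract e g) ?_ (Distr.supp_contract_subset e hs g)
    (Distr.supp_fourier_contract_subset e hsF g) x hx f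
  rintro ⟨a, s⟩ ha f
  obtain ⟨ha, rfl : s = 1⟩ := mem_CGroup_iff.1 ha
  -- The group `C_A` embeds in `C_{A ⊕ B}` by `a ↦ a ⊕ 1`, which leaves `g` untouched.
  have := hη (blockGTilde e a 1 1)
    (mem_CGroup_iff.2 ⟨blockGTilde_mem_CTilde e ha (one_mem (CTilde B)), rfl⟩)
    (Schwartz.tensor e f g)
  rw [translate_tensor, show (⟨1, 1⟩ : GTilde F κ) = 1 from rfl, translate_one] at this
  exact this

/-- The action of `(g ⊕ h)T` is done in two moves, one in each group of variables. A single move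
applies `T` on one side only and is not the action of a block element, so invariance under it has to
come from niceness of the summand. -/
theorem IsNice.blockSum (e : ι ⊕ κ ≃ m) {A : Matrix ι ι F} {B : Matrix κ κ F}
    (hA : IsNice hψ hψ1 A) (hB : IsNice hψ hψ1 B) : IsNice hψ hψ1 (blockSum e A B) := by
  refine ⟨by rw [trace_blockSum, hA.1, hB.1, add_zero], isNilpotent_blockSum e hA.2.1 hB.2.1,
    fun η hη hs hsF => ?_⟩
  obtain ⟨⟨g, s⟩, hg, rfl : s = -1⟩ := exists_mem_CTilde_right hA.2.1
  obtain ⟨⟨h, s⟩, hh, rfl : s = -1⟩ := exists_mem_CTilde_right hB.2.1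
  refine Distr.isInvariant_CTilde hη (blockGTilde_mem_CTilde e hg hh) rfl fun f => ?_
  refine LinearMap.congr_fun (f := η ∘ₗ Schwartz.translate (blockGTilde e g h (-1))) (g := η)
    (Distr.ext_tensor e fun f₁ f₂ => ?_) f
  rw [LinearMap.comp_apply, translate_tensor, hA.translate_tensor_left e hη hs hsF hg]
  -- Exchange the summands, so that the result on the first variable applies to `B`.
  rw [← blockSum_sumComm] at hη hs hsF
  simpa only [Schwartz.tensor_sumComm] using
    hB.translate_tensor_left ((Equiv.sumComm κ ι).trans e) hη hs hsF hh f₂ f₁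

end DirectSum
end GLMultOne

theorem mainTheorem8 {F : Type*} [Field F] [CharZero F] [ValuativeRel F] [TopologicalSpace F]
    [IsNonarchimedeanLocalField F] (ψ : AddChar F Circle) (hψ : Continuous ψ) (hψ1 : ψ ≠ 1)
    (k l : ℕ) (A₁ : Matrix (Fin k) (Fin k) F) (A₂ : Matrix (Fin l) (Fin l) F)
    (h₁ : GLMultOne.IsNice hψ hψ1 A₁) (h₂ : GLMultOne.IsNice hψ hψ1 A₂) :
    GLMultOne.IsNice hψ hψ1 (GLMultOne.directSum A₁ A₂) :=
  -- `directSum` is by definition `blockSum` along `finSumFinEquiv`.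
  GLMultOne.IsNice.blockSum finSumFinEquiv h₁ h₂
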